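/- Let $\mathfrak H$ be a separable complex Hilbert space. Linear relations in $\mathfrak H$ are subspaces of $\mathfrak H\times\mathfrak H$, and operators are identified with their graphs. A relation $T$ is nonnegative if $(f',f)\ge 0$ for all $\{f,f'\}\in T$, and selfadjoint if $T^*=T$. For a nonnegative selfadjoint relation $T$, let $T[\cdot,\cdot]$, with domain $\mathcal D[T]$, denote the corresponding closed nonnegative form, i.e. the closed nonnegative form with $\operatorname{dom}T\subset\mathcal D[T]$ and $T[f,k]=(f',k)$ for all $\{f,f'\}\in T$, $k\in\mathcal D[T]$; write $T[u]=T[u,u]$. Let $S$ be a closed nonnegative symmetric operator in $\mathfrak H$, not necessarily densely defined, and assume that $S$ admits disjoint nonnegative selfadjoint operator extensions, i.e. there are nonnegative selfadjoint operators $A_0,A_1\supset S$ with $A_0\cap A_1=S$ (intersection of graphs). Then there is a pair $\{\widetilde S_0,\widetilde S_1\}$ of nonnegative selfadjoint extensions (in general, linear relations) of $S$ such that 1. $\widetilde S_0\cap\widetilde S_1=S$; 2. the form $\widetilde S_0[\cdot,\cdot]$ is a closed restriction of the form $\widetilde S_1[\cdot,\cdot]$; 3. $\inf\{\widetilde S_1[u-\varphi]:\varphi\in\mathcal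 D[\widetilde S_0]\}=0$ for all $u\in\mathcal D[\widetilde S_1]$. Moreover, if $n_\pm(S)=\infty$, where $n_\pm(S)=\dim\bigl(\mathfrak H\ominus\operatorname{ran}(S\mp iI)\bigr)$ are the defect numbers of $S$, then there is such a pair $\{\widetilde S_0,\widetilde S_1\}$ with $\{\widetilde S_0,\widetilde S_1\}\ne\{S_{\rm F},S_{\rm K}\}$. Here $S_{\rm F}$ is the Friedrichs extension of $S$, i.e. the selfadjoint relation that corresponds to the closure (the smallest closed extension) of the form $(f',g)$, $\{f,f'\}\in S$, $g\in\operatorname{dom}S$, and $S_{\rm K}=((S^{-1})_{\rm F})^{-1}$ is the Kreĭn-von Neumann extension of $S$, where $S^{-1}$ is the inverse relation and $(S^{-1})_{\rm F}$ is defined in the same way. -/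

import Mathlib

open Filter Topology

namespace NonnegExt

variable {H : Type*} [NormedAddCommGroup H] [InnerProductSpace ℂ H]

/-! ### Linear relations

A linear relation in `H` is a subspace of `H × H`; an operator is identified with its graph. -/

/-- The relation `T` is symmetric: `(f', g) = (f, g')` for all `{f, f'}, {g, g'} ∈ T`. -/
def IsSymm (T : Submodule ℂ (H × H)) : Prop :=
  ∀ p ∈ T, ∀ q ∈ T, inner ℂ p.2 q.1 = inner ℂ p.1 q.2

/-- The relation `T` is nonnegative: for all `{f, f'} ∈ T` the number `(f', f)` is real and
nonnegative. -/
def IsNonneg (T : Submodule ℂ (H × H)) : Prop :=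
  ∀ p ∈ T, 0 ≤ (inner ℂ p.2 p.1).re ∧ (inner ℂ p.2 p.1).im = 0

/-- The relation `T` is nonnegative and selfadjoint, `T* = T`. -/
def IsNonnegSelfAdjoint (T : Submodule ℂ (H × H)) : Prop :=
  T.adjoint = T ∧ IsNonneg T

/-- The inverse relation `{ {f', f} : {f, f'} ∈ T }`. -/
def relInv (T : Submodule ℂ (H × H)) : Submodule ℂ (H × H) :=
  T.comap (LinearMap.prod (LinearMap.snd ℂ H H) (LinearMap.fst ℂ H H))

/-- The range of `T - w I`. -/
noncomputable def ranSub (T : Submodule ℂ (H × H)) (w : ℂ) : Submodule ℂ H :=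
  T.map (LinearMap.snd ℂ H H - w • LinearMap.fst ℂ H H)

/-- The defect subspace `H ⊖ ran (T - conj z I)`. -/
noncomputable def defectSubspace (T : Submodule ℂ (H × H)) (z : ℂ) : Submodule ℂ H :=
  (ranSub T (starRingEnd ℂ z))ᗮ

/-- The dimension, finite or infinite, of the defect subspace at `z`. -/
noncomputable def defectNumber (T : Submodule ℂ (H × H)) (z : ℂ) : ℕ∞ :=
  Cardinal.toENat (Module.rank ℂ (defectSubspace T z))

/-! ### Nonnegative forms -/

/-- A nonnegative sesquilinear form with a domain that is a (not necessarily dense, not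
necessarily closed) subspace of `H`.  As for the inner product of Mathlib, the first argument is
the conjugate linear one. -/
structure NonnegForm (H : Type*) [NormedAddCommGroup H] [InnerProductSpace ℂ H] where
  /-- the domain of the form -/
  domain : Submodule ℂ H
  /-- the values of the form -/
  form : domain →ₗ⋆[ℂ] domain →ₗ[ℂ] ℂ
  symm : ∀ u v, starRingEnd ℂ (form u v) = form v u
  nonneg : ∀ u, 0 ≤ (form u u).re

namespace NonnegForm

/-- The quadratic form `h[u] = h[u, u]`, a nonnegative real number. -/
def quad (h : NonnegForm H) (u : h.domain) : ℝ := (h.form u u).re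

/-- The form is closed: if `uₙ → u` in `H` and `h[uₙ - uₘ] → 0`, with all `uₙ` in the domain, then
`u` is in the domain and `h[uₙ - u] → 0`. -/
def IsClosed (h : NonnegForm H) : Prop :=
  ∀ (x : ℕ → h.domain) (u : H),
    Tendsto (fun n => (x n : H)) atTop (𝓝 u) →
    Tendsto (fun k : ℕ × ℕ => h.quad (x k.1 - x k.2)) atTop (𝓝 0) →
    ∃ hu : u ∈ h.domain, Tendsto (fun n => h.quad (x n - ⟨u, hu⟩)) atTop (𝓝 0)

/-- The form `h₁` is a restriction of the form `h₂`. -/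
def IsRestriction (h₁ h₂ : NonnegForm H) : Prop :=
  ∃ hle : h₁.domain ≤ h₂.domain, ∀ u v : h₁.domain,
    h₁.form u v = h₂.form (Submodule.inclusion hle u) (Submodule.inclusion hle v)

/-- The form `h` is the closed form `T[·,·]` that corresponds to the nonnegative selfadjoint
relation `T`: it is closed, `dom T ⊆ dom h`, and `h[f, k] = (f', k)` for all `{f, f'} ∈ T` and
`k ∈ dom h`. -/
def IsFormOf (h : NonnegForm H) (T : Submodule ℂ (H × H)) : Prop :=
  h.IsClosed ∧ ∀ p ∈ T, ∃ hp : p.1 ∈ h.domain, ∀ k : h.domain,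
    h.form ⟨p.1, hp⟩ k = inner ℂ p.2 (k : H)

/-- The form `h` extends the form `(f', g)`, `{f, f'} ∈ S`, `g ∈ dom S`, of the relation `S`. -/
def ExtendsFormOf (h : NonnegForm H) (S : Submodule ℂ (H × H)) : Prop :=
  ∀ p ∈ S, ∀ q ∈ S, ∃ (hp : p.1 ∈ h.domain) (hq : q.1 ∈ h.domain),
    h.form ⟨p.1, hp⟩ ⟨q.1, hq⟩ = inner ℂ p.2 q.1

/-- The form `h` is the closure, i.e. the smallest closed extension, of the form
`(f', g)`, `{f, f'} ∈ S`, `g ∈ dom S`, of the relation `S`. -/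
def IsClosureOfFormOf (h : NonnegForm H) (S : Submodule ℂ (H × H)) : Prop :=
  h.IsClosed ∧ h.ExtendsFormOf S ∧
    ∀ g : NonnegForm H, g.IsClosed → g.ExtendsFormOf S → h.IsRestriction g

end NonnegForm

/-! ### The Friedrichs and the Kreĭn-von Neumann extension -/

/-- `T` is the Friedrichs extension `S_F` of `S`: the selfadjoint relation that corresponds to the
closure of the form of `S`. -/
def IsFriedrichsExtension (S T : Submodule ℂ (H × H)) : Prop :=
  IsNonnegSelfAdjoint T ∧ ∃ h : NonnegForm H, h.IsClosureOfFormOf S ∧ h.IsFormOf T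

/-- `T` is the Kreĭn-von Neumann extension `S_K = ((S⁻¹)_F)⁻¹` of `S`. -/
def IsKreinExtension (S T : Submodule ℂ (H × H)) : Prop :=
  IsFriedrichsExtension (relInv S) (relInv T)

/-! ### The special pairs -/

/-- `S₀` and `S₁` are nonnegative selfadjoint extensions of `S` with intersection `S`, the form
`S₀[·,·]` is a closed restriction of the form `S₁[·,·]`, and
`inf { S₁[u - φ] : φ ∈ D[S₀] } = 0` for all `u ∈ D[S₁]`. -/
def IsSpecialPair (S S₀ S₁ : Submodule ℂ (H × H)) : Prop :=
  IsNonnegSelfAdjoint S₀ ∧ IsNonnegSelfAdjoint S₁ ∧ S ≤ S₀ ∧ S ≤ S₁ ∧ S₀ ⊓ S₁ = S ∧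
  ∃ h₀ h₁ : NonnegForm H, h₀.IsFormOf S₀ ∧ h₁.IsFormOf S₁ ∧ h₀.IsRestriction h₁ ∧
    ∀ u : h₁.domain,
      IsGLB {r : ℝ | ∃ φ : h₁.domain, (φ : H) ∈ h₀.domain ∧ r = h₁.quad (u - φ)} 0

/-! ### The two extensions are determined by `S` -/

theorem IsFriedrichsExtension.unique {S T T' : Submodule ℂ (H × H)}
    (hT : IsFriedrichsExtension S T) (hT' : IsFriedrichsExtension S T') : T = T' := by
  obtain ⟨⟨hs, -⟩, h, hc, hf⟩ := hT
  obtain ⟨⟨hs', -⟩, h', hc', hf'⟩ := hT'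
  obtain ⟨hle, hr⟩ := hc.2.2 h' hc'.1 hc'.2.1
  obtain ⟨hle', -⟩ := hc'.2.2 h hc.1 hc.2.1
  have key : ∀ p ∈ T, ∀ q ∈ T', inner ℂ p.2 q.1 = inner ℂ p.1 q.2 := by
    intro p hp q hq
    obtain ⟨hp1, hpk⟩ := hf.2 p hp
    obtain ⟨hq1, hqk⟩ := hf'.2 q hq
    have e1 := hpk ⟨q.1, hle' hq1⟩
    have e2 := hqk ⟨p.1, hle hp1⟩
    have e3 := hr ⟨p.1, hp1⟩ ⟨q.1, hle' hq1⟩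
    have e4 := h'.symm ⟨q.1, hq1⟩ ⟨p.1, hle hp1⟩
    rw [e2, inner_conj_symm] at e4
    exact (e1.symm.trans e3).trans e4.symm
  apply le_antisymm
  · intro p hp
    rw [← hs', Submodule.mem_adjoint_iff]
    intro a b hab
    have := key p hp (a, b) hab
    rw [← inner_conj_symm b, ← inner_conj_symm a, ← map_sub, ← this, sub_self, map_zero]
  · intro q hq
    rw [← hs, Submodule.mem_adjoint_iff]
    intro a b hab
    exact sub_eq_zero.2 (key (a, b) hab q hq)

theorem IsKreinExtension.unique {S T T' : Submodule ℂ (H × H)}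
    (hT : IsKreinExtension S T) (hT' : IsKreinExtension S T') : T = T' := by
  have h := IsFriedrichsExtension.unique hT hT'
  ext ⟨a, b⟩
  exact (SetLike.ext_iff.1 h (b, a))

end NonnegExt

/-! A nonnegative selfadjoint relation is encoded by its resolvent `R` at -1, where 0 ≤ R ≤ 1
(`exists_eq_relOf`), and inverting the relation replaces R by 1 - R. If R = C C* with C injective,
the closed form lives on ran C and h[Cx] = ‖x‖² - ‖Cx‖² (`formOf`). The theorem thus becomes a
question about splitting the identity into operators C C*.

Put D = ran (S + I). A resolvent of an extension of S is prescribed on D. The smallest one, A A*,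
belongs to the Friedrichs extension; the same construction for S⁻¹ gives B B*, and 1 - B B* belongs
to the Kreĭn extension. Disjointness of the given extensions forces the kernel of 1 - A A* - B B* to
be exactly D, so 1 = A A* + J J* + B B* with J injective on D^⊥ (`exists_resolvent_decomposition`).

Each splitting 1 = α α* + μ μ* + η η* of the identity of D^⊥ gives resolvents R₀ = A A* + Jα(Jα)*
and R₁ = R₀ + Jμ(Jμ)*. The form of R₀ is a restriction of that of R₁ if the row (α, μ) is injective,
the infimum is 0 if ran μ meets ran η trivially with μ injective, and the intersection is S if μ* is
injective (`isSpecialPair_of_decomposition`). The choice α = η = 0, μ = 1 is the Friedrichs–Kreĭn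
pair.

A pair with α ≠ 0 and μ ≠ 0 is a different one. Infinite defect makes D^⊥ infinite-dimensional, and
there such a splitting is built from two injective selfadjoint contractions of ℓ² whose ranges meet
only in 0 (`exists_one_decomposition`). -/

namespace NonnegExt

open scoped InnerProduct

/-! ### Nonnegative selfadjoint relations and their resolvents at -1. -/

section Relations

variable {H : Type*} [NormedAddCommGroup H] [InnerProductSpace ℂ H]

theorem inner_self_eq_ofReal (x : H) : inner ℂ x x = ((‖x‖ ^ 2 : ℝ) : ℂ) := by
  rw [inner_self_eq_norm_sq_to_K]; norm_cast

/-- The relation `{ {R g, g - R g} : g ∈ H }`, whose resolvent at `-1` is `R`. -/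
def relOf (R : H →L[ℂ] H) : Submodule ℂ (H × H) where
  carrier := {p | R (p.1 + p.2) = p.1}
  zero_mem' := by simp
  add_mem' {p q} hp hq := by
    simp only [Set.mem_ofPred_eq, Prod.fst_add, Prod.snd_add] at *
    rw [add_add_add_comm, map_add, hp, hq]
  smul_mem' c p hp := by
    simp only [Set.mem_ofPred_eq, Prod.smul_fst, Prod.smul_snd] at *
    rw [← smul_add, map_smul, hp]

theorem mem_relOf {R : H →L[ℂ] H} {p : H × H} : p ∈ relOf R ↔ R (p.1 + p.2) = p.1 := Iff.rfl

theorem mk_mem_relOf (R : H →L[ℂ] H) (g : H) : (R g, g - R g) ∈ relOf R := by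
  simp [mem_relOf]

theorem relOf_injective {R R' : H →L[ℂ] H} (h : relOf R = relOf R') : R = R' := by
  ext g
  have := mk_mem_relOf R g
  rw [h, mem_relOf] at this
  simpa using this.symm

theorem relInv_relOf (R : H →L[ℂ] H) : relInv (relOf R) = relOf (1 - R) := by
  ext ⟨a, b⟩
  change R (b + a) = b ↔ (a + b) - R (a + b) = a
  rw [add_comm b a]
  constructor
  · intro h; rw [h]; simp
  · intro h; rw [sub_eq_iff_eq_add] at h; exact (add_left_cancel h).symm

variable {G : Type*} [NormedAddCommGroup G] [InnerProductSpace ℂ G]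

theorem norm_le_of_isPositive_one_sub [CompleteSpace H] [CompleteSpace G] {C : G →L[ℂ] H}
    (hC : (1 - C ∘L C†).IsPositive) (x : G) : ‖C x‖ ≤ ‖x‖ := by
  have hadj : ∀ y, ‖(C†) y‖ ≤ ‖y‖ := by
    intro y
    have h := hC.re_inner_nonneg_left y
    have e : inner ℂ ((1 - C ∘L C†) y) y = inner ℂ y y - inner ℂ ((C†) y) ((C†) y) := by
      rw [ContinuousLinearMap.adjoint_inner_left, sub_apply, inner_sub_left,
        one_apply_eq_self, ContinuousLinearMap.comp_apply,
        ← ContinuousLinearMap.adjoint_inner_right, ContinuousLinearMap.adjoint_inner_left]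
    rw [e, inner_self_eq_ofReal, inner_self_eq_ofReal, ← Complex.ofReal_sub] at h
    have h' : 0 ≤ ‖y‖ ^ 2 - ‖(C†) y‖ ^ 2 := h
    nlinarith [norm_nonneg y, norm_nonneg ((C†) y)]
  have h1 : ‖C x‖ ^ 2 ≤ ‖x‖ * ‖C x‖ := by
    have := C.apply_norm_sq_eq_inner_adjoint_left x
    rw [this]
    refine (Complex.re_le_norm _).trans ((norm_inner_le_norm _ _).trans ?_)
    rw [mul_comm]
    exact mul_le_mul_of_nonneg_left (hadj _) (norm_nonneg _)
  by_contra! hlt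
  nlinarith [norm_nonneg x]

/-- For {a, b} in the relation, a = C C*(a + b), hence (b, a) = ‖C*(a + b)‖² - ‖a‖², which is
nonnegative because C is a contraction. -/
theorem isNonnegSelfAdjoint_relOf [CompleteSpace H] [CompleteSpace G] {C : G →L[ℂ] H}
    (hC : ∀ x, ‖C x‖ ≤ ‖x‖) : IsNonnegSelfAdjoint (relOf (C ∘L C†)) := by
  have hs : ∀ x y, inner ℂ ((C ∘L C†) x) y = inner ℂ x ((C ∘L C†) y) := fun x y ↦ by
    rw [ContinuousLinearMap.comp_apply, ContinuousLinearMap.comp_apply,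
      ← ContinuousLinearMap.adjoint_inner_right, ContinuousLinearMap.adjoint_inner_left]
  set R := C ∘L C† with hR
  refine ⟨le_antisymm ?_ ?_, ?_⟩
  · rintro ⟨a, b⟩ h
    rw [Submodule.mem_adjoint_iff] at h
    rw [mem_relOf]
    refine ext_inner_left ℂ fun g ↦ ?_
    have := h _ _ (mk_mem_relOf R g)
    simp only [inner_sub_left, hs] at this
    rw [map_add, inner_add_right, ← sub_eq_zero, ← neg_eq_zero, ← this]
    ring
  · rintro ⟨a, b⟩ h
    rw [Submodule.mem_adjoint_iff]
    intro c d h'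
    rw [mem_relOf] at h h'
    simp only at h h'
    have h1 : inner ℂ d a = inner ℂ (c + d) a - inner ℂ c a := by rw [inner_add_left]; ring
    have h2 : inner ℂ c b = inner ℂ c (a + b) - inner ℂ c a := by rw [inner_add_right]; ring
    have h3 := hs (c + d) (a + b)
    rw [h, h'] at h3
    rw [h1, h2, h3]; ring
  · rintro ⟨a, b⟩ h
    rw [mem_relOf] at h
    simp only at h ⊢
    have e : inner ℂ b a = inner ℂ ((C†) (a + b)) ((C†) (a + b)) - inner ℂ a a := by
      rw [ContinuousLinearMap.adjoint_inner_left]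
      change _ = inner ℂ _ (R (a + b)) - _
      rw [h, inner_add_left]; ring
    have h4 := hC ((C†) (a + b))
    rw [show C ((C†) (a + b)) = a from h] at h4
    rw [e, inner_self_eq_ofReal, inner_self_eq_ofReal, ← Complex.ofReal_sub]
    refine ⟨?_, Complex.ofReal_im _⟩
    rw [Complex.ofReal_re]
    nlinarith [norm_nonneg a]

/-- On `A` the map {f, f'} ↦ f + f' is bounded below, since nonnegativity controls the cross term;
as `A` is closed, so is the range. The operator R is the first component of the inverse of this map.
-/
theorem exists_eq_relOf [CompleteSpace H] {A : Submodule ℂ (H × H)}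
    (hA : IsNonnegSelfAdjoint A) :
    ∃ R : H →L[ℂ] H, R.IsPositive ∧ (1 - R).IsPositive ∧ A = relOf R := by
  obtain ⟨hadj, hnn⟩ := hA
  have hnorm : ∀ p ∈ A, ‖p.1‖ ^ 2 + ‖p.2‖ ^ 2 ≤ ‖p.1 + p.2‖ ^ 2 := by
    intro p hp
    have := (hnn p hp).1
    rw [norm_add_sq (𝕜 := ℂ), ← inner_conj_symm]
    simp only [RCLike.re_to_complex, Complex.conj_re]
    linarith
  have hclosed : IsClosed (A : Set (H × H)) := by
    have : (A : Set (H × H)) = ⋂ q ∈ A, {p : H × H | inner ℂ q.2 p.1 - inner ℂ q.1 p.2 = 0} := by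
      ext p
      conv_lhs => rw [← hadj]
      simp [Submodule.mem_adjoint_iff]
    rw [this]
    refine isClosed_biInter fun q _ ↦ isClosed_eq (by fun_prop) continuous_const
  let σ : A →L[ℂ] H :=
    (ContinuousLinearMap.fst ℂ H H + ContinuousLinearMap.snd ℂ H H) ∘L A.subtypeL
  have hσ : ∀ p : A, ‖p‖ ≤ ‖σ p‖ := by
    rintro ⟨p, hp⟩
    have := hnorm p hp
    change max ‖p.1‖ ‖p.2‖ ≤ ‖p.1 + p.2‖
    have h0 := norm_nonneg (p.1 + p.2)
    refine max_le ?_ ?_ <;> refine abs_le_of_sq_le_sq' ?_ h0 |>.2 <;>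
      nlinarith [sq_nonneg ‖p.1‖, sq_nonneg ‖p.2‖]
  have : CompleteSpace A := hclosed.completeSpace_coe
  have hanti : AntilipschitzWith 1 σ := by
    refine AddMonoidHomClass.antilipschitz_of_bound σ fun p ↦ ?_
    simpa using hσ p
  have hrange : IsClosed (Set.range σ) := hanti.isClosed_range σ.uniformContinuous
  have hsurj : Function.Surjective σ := by
    have hcl : IsClosed (LinearMap.range (σ : A →ₗ[ℂ] H) : Set H) := hrange
    have : CompleteSpace (LinearMap.range (σ : A →ₗ[ℂ] H)) := hcl.completeSpace_coe
    refine LinearMap.range_eq_top (f := (σ : A →ₗ[ℂ] H)).1 ?_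
    rw [← Submodule.orthogonal_eq_bot_iff, Submodule.eq_bot_iff]
    intro h hh
    -- A vector orthogonal to the range gives {h, -h} in the adjoint, that is in `A`, and
    -- nonnegativity then reads -‖h‖² ≥ 0.
    have hmem : (h, -h) ∈ A := by
      rw [← hadj, Submodule.mem_adjoint_iff]
      intro a b hab
      have := hh (a + b) ⟨⟨(a, b), hab⟩, rfl⟩
      rw [inner_add_left] at this
      simpa [add_comm] using this
    have h1 := (hnn _ hmem).1
    rw [inner_neg_left, inner_self_eq_norm_sq_to_K] at h1
    have h2 : ‖h‖ ^ 2 ≤ 0 := by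
      have : (0 : ℝ) ≤ -(‖h‖ ^ 2) := by exact_mod_cast h1
      linarith
    exact norm_eq_zero.1 (pow_eq_zero_iff two_ne_zero |>.1 (le_antisymm h2 (sq_nonneg _)))
  have hinj : Function.Injective σ := hanti.injective
  let e : A ≃ₗ[ℂ] H := LinearEquiv.ofBijective (σ : A →ₗ[ℂ] H) ⟨hinj, hsurj⟩
  let R : H →L[ℂ] H := ((LinearMap.fst ℂ H H) ∘ₗ A.subtype ∘ₗ (e.symm : H →ₗ[ℂ] A)).mkContinuous 1
    (fun g ↦ by
      have h1 := hσ (e.symm g)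
      have h2 : σ (e.symm g) = g := e.apply_symm_apply g
      rw [h2] at h1
      rw [one_mul]
      exact (le_max_left _ _).trans h1)
  have hRe : ∀ p : A, R (p.1.1 + p.1.2) = p.1.1 := fun p ↦ by
    change ((e.symm (e p) : A) : H × H).1 = _
    rw [e.symm_apply_apply]
  have hsplit : ∀ g : H, (R g, g - R g) ∈ A := by
    intro g
    obtain ⟨p, rfl⟩ := hsurj g
    change (R (p.1.1 + p.1.2), p.1.1 + p.1.2 - R (p.1.1 + p.1.2)) ∈ A
    rw [hRe, add_sub_cancel_left]
    exact p.2
  have hin : ∀ g : H, 0 ≤ (inner ℂ (R g) (g - R g)).re ∧ (inner ℂ (R g) (g - R g)).im = 0 := by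
    intro g
    have := hnn _ (hsplit g)
    simp only at this
    rw [← inner_conj_symm, Complex.conj_re, Complex.conj_im, neg_eq_zero]
    exact this
  refine ⟨R, ?_, ?_, ?_⟩
  · rw [ContinuousLinearMap.isPositive_iff_complex]
    intro g
    have h := hin g
    have e : inner ℂ (R g) g = inner ℂ (R g) (g - R g) + ((‖R g‖ ^ 2 : ℝ) : ℂ) := by
      rw [inner_sub_right, inner_self_eq_ofReal]; ring
    rw [e]
    refine ⟨Complex.ext (by simp) (Eq.symm ?_), ?_⟩
    · rw [Complex.add_im, Complex.ofReal_im, h.2, add_zero]; rfl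
    · rw [RCLike.re_to_complex, Complex.add_re, Complex.ofReal_re]
      have := h.1; positivity
  · rw [ContinuousLinearMap.isPositive_iff_complex]
    intro g
    have h := hin g
    have e : inner ℂ ((1 - R) g) g =
        starRingEnd ℂ (inner ℂ (R g) (g - R g)) + ((‖g - R g‖ ^ 2 : ℝ) : ℂ) := by
      rw [← inner_self_eq_ofReal, inner_conj_symm, ← inner_add_right, add_sub_cancel]; rfl
    rw [e]
    refine ⟨Complex.ext (by simp) (Eq.symm ?_), ?_⟩
    · rw [Complex.add_im, Complex.ofReal_im, Complex.conj_im,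
        h.2, neg_zero, add_zero]; rfl
    · rw [RCLike.re_to_complex, Complex.add_re, Complex.ofReal_re, Complex.conj_re]
      have := h.1; positivity
  · ext p
    refine ⟨fun hp ↦ hRe ⟨p, hp⟩, fun hp ↦ ?_⟩
    have := hsplit (p.1 + p.2)
    rw [mem_relOf] at hp
    rw [hp, add_sub_cancel_left] at this
    exact this

/-- The commutation clause serves the square roots of (1 - a²)/2, which have to commute with a. -/
theorem IsPositive.exists_isSelfAdjoint_comp_self [CompleteSpace H] {R : H →L[ℂ] H}
    (hR : R.IsPositive) :
    ∃ T : H →L[ℂ] H, T† = T ∧ T ∘L T = R ∧ ∀ B : H →L[ℂ] H, Commute R B → Commute T B := by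
  have h0 : 0 ≤ R := (ContinuousLinearMap.nonneg_iff_isPositive R).2 hR
  refine ⟨CFC.sqrt R, ?_, CFC.sqrt_mul_sqrt_self R, fun B hB ↦ ?_⟩
  · exact ((ContinuousLinearMap.nonneg_iff_isPositive _).1 (CFC.sqrt_nonneg R)).isSelfAdjoint.adjoint_eq
  · rw [CFC.sqrt]; exact hB.cfcₙ_nnreal _

variable {E F : Type*} [NormedAddCommGroup E] [InnerProductSpace ℂ E]
  [NormedAddCommGroup F] [InnerProductSpace ℂ F]

/-- The row operator `(x, y) ↦ A x + B y` on the orthogonal sum. -/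
noncomputable def rowL2 (A : E →L[ℂ] H) (B : F →L[ℂ] H) : WithLp 2 (E × F) →L[ℂ] H :=
  A ∘L WithLp.fstL 2 ℂ E F + B ∘L WithLp.sndL 2 ℂ E F

@[simp] theorem rowL2_apply (A : E →L[ℂ] H) (B : F →L[ℂ] H) (x : WithLp 2 (E × F)) :
    rowL2 A B x = A x.fst + B x.snd := rfl

theorem rowL2_adjoint_apply [CompleteSpace H] [CompleteSpace E] [CompleteSpace F]
    (A : E →L[ℂ] H) (B : F →L[ℂ] H) (y : H) :
    ((rowL2 A B)†) y = WithLp.toLp 2 ((A†) y, (B†) y) := by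
  refine ext_inner_right ℂ fun x ↦ ?_
  rw [ContinuousLinearMap.adjoint_inner_left]
  simp [inner_add_right, ContinuousLinearMap.adjoint_inner_left]

theorem rowL2_comp_adjoint [CompleteSpace H] [CompleteSpace E] [CompleteSpace F]
    (A : E →L[ℂ] H) (B : F →L[ℂ] H) :
    rowL2 A B ∘L (rowL2 A B)† = A ∘L A† + B ∘L B† := by
  ext y
  simp [rowL2_adjoint_apply]

end Relations

/-! ### Forms on ranges of injective contractions, and the Friedrichs extension. -/

section Forms

variable {H : Type*} [NormedAddCommGroup H] [InnerProductSpace ℂ H]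
  {G : Type*} [NormedAddCommGroup G] [InnerProductSpace ℂ G]

theorem ofInjective_symm_mk {C : G →L[ℂ] H} (hinj : Function.Injective (C : G →ₗ[ℂ] H)) (x : G)
    (hx : C x ∈ LinearMap.range (C : G →ₗ[ℂ] H)) :
    (LinearEquiv.ofInjective (C : G →ₗ[ℂ] H) hinj).symm ⟨C x, hx⟩ = x := by
  rw [LinearEquiv.symm_apply_eq]; rfl

/-- The form `h[C x, C y] = (x, y) - (C x, C y)` on the range of an injective contraction `C`. -/
noncomputable def formOf (C : G →L[ℂ] H) (hinj : Function.Injective (C : G →ₗ[ℂ] H))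
    (hC : ∀ x, ‖C x‖ ≤ ‖x‖) : NonnegForm H where
  domain := LinearMap.range (C : G →ₗ[ℂ] H)
  form := LinearMap.mk₂'ₛₗ (starRingEnd ℂ) (RingHom.id ℂ)
    (fun u v ↦ inner ℂ ((LinearEquiv.ofInjective (C : G →ₗ[ℂ] H) hinj).symm u)
      ((LinearEquiv.ofInjective (C : G →ₗ[ℂ] H) hinj).symm v) - inner ℂ (u : H) (v : H))
    (fun u u' v ↦ by simp only [map_add, inner_add_left, Submodule.coe_add]; ring)
    (fun c u v ↦ by simp only [map_smul, inner_smul_left, Submodule.coe_smul, smul_eq_mul]; ring)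
    (fun u v v' ↦ by simp only [map_add, inner_add_right, Submodule.coe_add]; ring)
    (fun c u v ↦ by
      simp only [map_smul, inner_smul_right, Submodule.coe_smul, smul_eq_mul, RingHom.id_apply]
      ring)
  symm u v := by simp
  nonneg := by
    rintro ⟨_, x, rfl⟩
    simp only [LinearMap.mk₂'ₛₗ_apply]
    erw [ofInjective_symm_mk hinj x ⟨x, rfl⟩]
    rw [inner_self_eq_ofReal, inner_self_eq_ofReal, ← Complex.ofReal_sub, Complex.ofReal_re,
      sub_nonneg]
    exact pow_le_pow_left₀ (norm_nonneg _) (hC x) 2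

variable {C : G →L[ℂ] H} {hinj : Function.Injective (C : G →ₗ[ℂ] H)} {hC : ∀ x, ‖C x‖ ≤ ‖x‖}

theorem mem_formOf_domain (x : G) : C x ∈ (formOf C hinj hC).domain := ⟨x, rfl⟩

theorem formOf_form (x y : G) (hx : C x ∈ (formOf C hinj hC).domain)
    (hy : C y ∈ (formOf C hinj hC).domain) :
    (formOf C hinj hC).form ⟨C x, hx⟩ ⟨C y, hy⟩ = inner ℂ x y - inner ℂ (C x) (C y) := by
  exact congrArg₂ (fun a b ↦ inner ℂ a b - inner ℂ (C x) (C y))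
    (ofInjective_symm_mk hinj x hx) (ofInjective_symm_mk hinj y hy)

theorem formOf_quad (x : G) (hx : C x ∈ (formOf C hinj hC).domain) :
    (formOf C hinj hC).quad ⟨C x, hx⟩ = ‖x‖ ^ 2 - ‖C x‖ ^ 2 := by
  rw [NonnegForm.quad, formOf_form, inner_self_eq_ofReal, inner_self_eq_ofReal,
    ← Complex.ofReal_sub, Complex.ofReal_re]

/-- Since h[Cx] + ‖Cx‖² = ‖x‖², the form norm on ran C is the norm of the complete space `G`. -/
theorem formOf_isClosed [CompleteSpace G] : (formOf C hinj hC).IsClosed := by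
  intro u a hu hq
  choose x hx using fun n ↦ (u n).2
  have hu' : ∀ n, u n = ⟨C (x n), mem_formOf_domain _⟩ := fun n ↦ Subtype.ext (hx n).symm
  have hux : ∀ n, (u n : H) = C (x n) := fun n ↦ (hx n).symm
  have hsub : ∀ n y, u n - (⟨C y, mem_formOf_domain _⟩ : (formOf C hinj hC).domain) =
      ⟨C (x n - y), mem_formOf_domain _⟩ := fun n y ↦ Subtype.ext (by
    exact (congrArg (· - C y) (hux n)).trans (map_sub C _ _).symm)
  have hcau : CauchySeq x := by
    rw [cauchySeq_iff_tendsto_dist_atTop_0]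
    have h1 : Tendsto (fun k : ℕ × ℕ ↦ dist (u k.1 : H) (u k.2 : H)) atTop (𝓝 0) :=
      cauchySeq_iff_tendsto_dist_atTop_0.1 hu.cauchySeq
    have h2 := (hq.add (h1.pow 2)).sqrt
    simp only [ne_eq, OfNat.ofNat_ne_zero, not_false_eq_true, zero_pow, add_zero,
      Real.sqrt_zero] at h2
    refine h2.congr fun k ↦ ?_
    rw [hux k.1, hux k.2, hu' k.2, hsub, formOf_quad, dist_eq_norm, dist_eq_norm, ← map_sub,
      sub_add_cancel, Real.sqrt_sq (norm_nonneg _)]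
  obtain ⟨y, hy⟩ := cauchySeq_tendsto_of_complete hcau
  have hCy : C y = a := by
    refine tendsto_nhds_unique ((C.continuous.tendsto y).comp hy) (hu.congr fun n ↦ hux n)
  subst hCy
  refine ⟨⟨y, rfl⟩, ?_⟩
  have h3 : Tendsto (fun n ↦ ‖x n - y‖ ^ 2 - ‖C (x n - y)‖ ^ 2) atTop (𝓝 0) := by
    have h4 : Tendsto (fun n ↦ x n - y) atTop (𝓝 0) := by
      simpa using hy.sub_const y
    have h5 : Continuous fun z : G ↦ ‖z‖ ^ 2 - ‖C z‖ ^ 2 := by fun_prop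
    have h6 := (h5.tendsto 0).comp h4
    simp only [norm_zero, map_zero, sub_self] at h6
    exact h6
  refine h3.congr fun n ↦ ?_
  rw [hsub, formOf_quad]

theorem formOf_isFormOf [CompleteSpace G] [CompleteSpace H] :
    (formOf C hinj hC).IsFormOf (relOf (C ∘L C†)) := by
  refine ⟨formOf_isClosed, ?_⟩
  rintro ⟨a, b⟩ hp
  rw [mem_relOf] at hp
  have ha : C ((C†) (a + b)) = a := hp
  refine ⟨⟨_, ha⟩, ?_⟩
  rintro ⟨_, y, rfl⟩
  have := formOf_form (hinj := hinj) (hC := hC) ((C†) (a + b)) y ⟨_, rfl⟩ ⟨_, rfl⟩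
  simp only [ha] at this
  refine this.trans ?_
  rw [ContinuousLinearMap.adjoint_inner_left, inner_add_left]
  simp

namespace NonnegForm

variable (h : NonnegForm H)

theorem quad_nonneg (u : h.domain) : 0 ≤ h.quad u := h.nonneg u

theorem norm_form_le (u v : h.domain) : ‖h.form u v‖ ≤ √(h.quad u) * √(h.quad v) := by
  let c : PreInnerProductSpace.Core ℂ h.domain :=
    { inner := fun u v ↦ h.form u v
      conj_inner_symm := fun u v ↦ h.symm v u
      re_inner_nonneg := h.nonneg
      add_left := fun u v w ↦ by simp
      smul_left := fun u v c ↦ by simp }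
  exact InnerProductSpace.Core.norm_inner_le_norm (c := c) u v

theorem tendsto_form {y w : ℕ → h.domain} {a b : h.domain}
    (hy : Tendsto (fun n ↦ h.quad (y n - a)) atTop (𝓝 0))
    (hw : Tendsto (fun n ↦ h.quad (w n - b)) atTop (𝓝 0)) :
    Tendsto (fun n ↦ h.form (y n) (w n)) atTop (𝓝 (h.form a b)) := by
  rw [tendsto_iff_norm_sub_tendsto_zero]
  have hy' := hy.sqrt
  have hw' := hw.sqrt
  have hlim := ((hy'.mul_const √(h.quad b)).add (hw'.const_mul √(h.quad a))).add (hy'.mul hw')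
  simp only [Real.sqrt_zero, zero_mul, mul_zero, add_zero] at hlim
  refine squeeze_zero (fun _ ↦ norm_nonneg _) (fun n ↦ ?_) hlim
  have e : h.form (y n) (w n) - h.form a b =
      h.form (y n - a) b + h.form a (w n - b) + h.form (y n - a) (w n - b) := by
    simp only [map_sub, LinearMap.sub_apply]; ring
  rw [e]
  refine (norm_add₃_le).trans ?_
  gcongr <;> exact h.norm_form_le _ _

end NonnegForm

/-- If `C₀ C₀* + C₁ C₁* + C₂ C₂* = 1`, the row `(C₀, C₁)` is injective and the range of `C₁` meets
the range of `C₂` trivially, then the form with resolvent `C₀ C₀*` is a restriction of the form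
with resolvent `C₀ C₀* + C₁ C₁*`, and its domain is dense for the latter form. -/
theorem exists_form_restriction {G₀ G₁ G₂ : Type*}
    [NormedAddCommGroup G₀] [InnerProductSpace ℂ G₀] [CompleteSpace G₀]
    [NormedAddCommGroup G₁] [InnerProductSpace ℂ G₁] [CompleteSpace G₁]
    [NormedAddCommGroup G₂] [InnerProductSpace ℂ G₂] [CompleteSpace G₂] [CompleteSpace H]
    {C₀ : G₀ →L[ℂ] H} {C₁ : G₁ →L[ℂ] H} {C₂ : G₂ →L[ℂ] H}
    (hsum : C₀ ∘L C₀† + C₁ ∘L C₁† + C₂ ∘L C₂† = 1)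
    (hker : ∀ x y, C₀ x + C₁ y = 0 → x = 0 ∧ y = 0) (hsing : ∀ y z, C₁ y = C₂ z → y = 0) :
    IsNonnegSelfAdjoint (relOf (C₀ ∘L C₀†)) ∧
    IsNonnegSelfAdjoint (relOf (C₀ ∘L C₀† + C₁ ∘L C₁†)) ∧
    ∃ h₀ h₁ : NonnegForm H, h₀.IsFormOf (relOf (C₀ ∘L C₀†)) ∧
      h₁.IsFormOf (relOf (C₀ ∘L C₀† + C₁ ∘L C₁†)) ∧ h₀.IsRestriction h₁ ∧
      ∀ u : h₁.domain,
        IsGLB {r : ℝ | ∃ φ : h₁.domain, (φ : H) ∈ h₀.domain ∧ r = h₁.quad (u - φ)} 0 := by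
  set C := rowL2 C₀ C₁ with hCdef
  have hCC : C ∘L C† = C₀ ∘L C₀† + C₁ ∘L C₁† := rowL2_comp_adjoint _ _
  rw [← hCC] at hsum ⊢
  have hC : ∀ x, ‖C x‖ ≤ ‖x‖ := by
    refine norm_le_of_isPositive_one_sub ?_
    rw [← hsum, add_sub_cancel_left]
    exact ContinuousLinearMap.isPositive_self_comp_adjoint _
  have hinj : Function.Injective (C : WithLp 2 (G₀ × G₁) →ₗ[ℂ] H) := by
    rw [injective_iff_map_eq_zero]
    intro x hx
    obtain ⟨h1, h2⟩ := hker x.fst x.snd hx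
    exact WithLp.ofLp_injective 2 (Prod.ext h1 h2)
  have hCι : ∀ x : G₀, C (WithLp.toLp 2 (x, 0)) = C₀ x := fun x ↦ by simp [hCdef]
  have hC₀ : ∀ x, ‖C₀ x‖ ≤ ‖x‖ := fun x ↦ by
    have := hC (WithLp.toLp 2 (x, 0))
    rw [hCι] at this
    simpa using this
  have hinj₀ : Function.Injective (C₀ : G₀ →ₗ[ℂ] H) := by
    rw [injective_iff_map_eq_zero]
    intro x hx
    exact (hker x 0 (by simpa using hx)).1
  refine ⟨isNonnegSelfAdjoint_relOf hC₀, isNonnegSelfAdjoint_relOf hC, formOf C₀ hinj₀ hC₀,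
    formOf C hinj hC, formOf_isFormOf, formOf_isFormOf, ⟨?_, ?_⟩, ?_⟩
  · rintro _ ⟨x, rfl⟩
    exact ⟨_, hCι x⟩
  · rintro ⟨_, x, rfl⟩ ⟨_, y, rfl⟩
    refine (formOf_form (hinj := hinj₀) (hC := hC₀) x y ⟨_, rfl⟩ ⟨_, rfl⟩).trans ?_
    have := formOf_form (hinj := hinj) (hC := hC) (WithLp.toLp 2 (x, 0)) (WithLp.toLp 2 (y, 0))
      ⟨_, rfl⟩ ⟨_, rfl⟩
    simp only [hCι] at this
    refine Eq.trans ?_ this.symm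
    simp
  · rintro ⟨_, x, rfl⟩
    let W := rowL2 C C₂
    -- The row W = (C, C₂) is a coisometry, so Q = 1 - W*W projects onto ker W. With Γ v = Q(v, 0)
    -- one gets ‖Γ v‖² = ‖v‖² - ‖Cv‖² = h₁[Cv], and it remains to show that Γ(G₀ × 0) is dense in
    -- the range of Γ.
    have hW : ∀ y, W ((W†) y) = y := fun y ↦ by
      have := DFunLike.congr_fun (rowL2_comp_adjoint C C₂) y
      rwa [hsum] at this
    let Q : WithLp 2 (WithLp 2 (G₀ × G₁) × G₂) →L[ℂ] WithLp 2 (WithLp 2 (G₀ × G₁) × G₂) :=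
      1 - W† ∘L W
    have hQ : ∀ z, Q z = z - (W†) (W z) := fun z ↦ rfl
    have hWQ : ∀ z, W (Q z) = 0 := fun z ↦ by rw [hQ, map_sub, hW, sub_self]
    have hQs : ∀ z w, inner ℂ z (Q w) = inner ℂ (Q z) w := fun z w ↦ by
      rw [hQ, hQ, inner_sub_left, inner_sub_right, ContinuousLinearMap.adjoint_inner_left,
        ContinuousLinearMap.adjoint_inner_right]
    have hQn : ∀ z, ‖Q z‖ ^ 2 = ‖z‖ ^ 2 - ‖W z‖ ^ 2 := fun z ↦ by
      have h1 : inner ℂ (Q z) (Q z) = inner ℂ z z - inner ℂ (W z) (W z) := by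
        rw [← hQs]
        conv_lhs => rw [hQ (Q z), hWQ, map_zero, sub_zero]
        rw [hQ, inner_sub_right, ContinuousLinearMap.adjoint_inner_right]
      rw [inner_self_eq_ofReal, inner_self_eq_ofReal, inner_self_eq_ofReal] at h1
      exact_mod_cast h1
    let Γ : WithLp 2 (G₀ × G₁) →ₗ[ℂ] WithLp 2 (WithLp 2 (G₀ × G₁) × G₂) :=
      (Q : _ →ₗ[ℂ] _) ∘ₗ (WithLp.linearEquiv 2 ℂ (WithLp 2 (G₀ × G₁) × G₂)).symm.toLinearMap ∘ₗ
        LinearMap.inl ℂ _ _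
    have hΓ : ∀ v, Γ v = Q (WithLp.toLp 2 (v, 0)) := fun v ↦ rfl
    have hΓn : ∀ v, ‖Γ v‖ ^ 2 = ‖v‖ ^ 2 - ‖C v‖ ^ 2 := fun v ↦ by
      rw [hΓ, hQn]; simp [W]
    let K : Submodule ℂ (WithLp 2 (WithLp 2 (G₀ × G₁) × G₂)) :=
      LinearMap.range (Γ ∘ₗ (WithLp.linearEquiv 2 ℂ (G₀ × G₁)).symm.toLinearMap ∘ₗ
        LinearMap.inl ℂ _ _)
    have hK : ∀ k : G₀, Γ (WithLp.toLp 2 (k, 0)) ∈ K := fun k ↦ ⟨k, rfl⟩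
    have hmem : Γ x ∈ K.topologicalClosure := by
      rw [← Submodule.orthogonal_orthogonal_eq_closure, Submodule.mem_orthogonal]
      intro r hr
      -- If r is orthogonal to Γ(G₀ × 0), then Q r = (0, y, z) lies in ker W, so C₁ y = -C₂ z and y
      -- = 0. Hence Q r = (0, 0, z) is orthogonal to (x, 0), which makes r orthogonal to Γ x.
      have h1 : (Q r).fst.fst = 0 := by
        refine ext_inner_right ℂ fun k ↦ ?_
        have := Submodule.inner_left_of_mem_orthogonal (hK k) hr
        rw [hΓ, hQs] at this
        simpa using this
      have h2 : (Q r).fst.snd = 0 := by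
        have h3 := hWQ r
        simp only [W, hCdef, rowL2_apply, h1, map_zero, zero_add] at h3
        refine hsing _ (-(Q r).snd) ?_
        rw [map_neg]
        exact eq_neg_of_add_eq_zero_left h3
      have h4 : (Q r).fst = 0 := WithLp.ofLp_injective 2 (Prod.ext h1 h2)
      rw [hΓ, hQs, WithLp.prod_inner_apply]
      simp [h4]
    refine ⟨?_, ?_⟩
    · rintro r ⟨φ, -, rfl⟩
      exact NonnegForm.quad_nonneg _ _
    · intro b hb
      refine le_of_forall_pos_lt_add fun ε hε ↦ ?_
      rw [zero_add]
      have hmem' : Γ x ∈ closure (K : Set _) := hmem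
      rw [Metric.mem_closure_iff] at hmem'
      obtain ⟨_, ⟨k, rfl⟩, hk⟩ := hmem' (√ε) (Real.sqrt_pos.2 hε)
      have hk' : dist (Γ x) (Γ (WithLp.toLp 2 (k, 0))) < √ε := hk
      rw [dist_eq_norm, ← map_sub, Real.lt_sqrt (norm_nonneg _), hΓn] at hk'
      refine lt_of_le_of_lt (hb ⟨⟨C (WithLp.toLp 2 (k, 0)), ⟨_, rfl⟩⟩, ?_, ?_⟩) hk'
      · exact ⟨k, (hCι k).symm⟩
      · rw [← formOf_quad (hinj := hinj) (hC := hC) _ ⟨_, rfl⟩]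
        congr 1
        exact Subtype.ext (map_sub C _ _)

/-- The range of `S + I`. -/
def sumRange (S : Submodule ℂ (H × H)) : Submodule ℂ H :=
  S.map (LinearMap.fst ℂ H H + LinearMap.snd ℂ H H)

theorem add_mem_sumRange {S : Submodule ℂ (H × H)} {p : H × H} (hp : p ∈ S) :
    p.1 + p.2 ∈ sumRange S := ⟨p, hp, rfl⟩

theorem sumRange_relInv (S : Submodule ℂ (H × H)) : sumRange (relInv S) = sumRange S := by
  ext g
  constructor
  · rintro ⟨⟨a, b⟩, hp, rfl⟩
    exact ⟨(b, a), hp, add_comm _ _⟩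
  · rintro ⟨⟨a, b⟩, hp, rfl⟩
    exact ⟨(b, a), hp, add_comm _ _⟩

/-- The closure of the image of a subspace. -/
def closedImage (T : H →L[ℂ] H) (D : Submodule ℂ H) : Submodule ℂ H :=
  (D.map (T : H →ₗ[ℂ] H)).topologicalClosure

instance (T : H →L[ℂ] H) (D : Submodule ℂ H) [CompleteSpace H] : CompleteSpace (closedImage T D) :=
  (Submodule.isClosed_topologicalClosure _).completeSpace_coe

theorem map_mem_closedImage (T : H →L[ℂ] H) {D : Submodule ℂ H} {g : H} (hg : g ∈ D) :
    T g ∈ closedImage T D :=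
  Submodule.le_topologicalClosure _ ⟨g, hg, rfl⟩

/-- The restriction of `T` to the closure of `T D`. -/
noncomputable def coreMap (T : H →L[ℂ] H) (D : Submodule ℂ H) : closedImage T D →L[ℂ] H :=
  T ∘L (closedImage T D).subtypeL

@[simp] theorem coreMap_apply (T : H →L[ℂ] H) (D : Submodule ℂ H) (x : closedImage T D) :
    coreMap T D x = T x := rfl

variable [CompleteSpace H]

/-- The kernel of a selfadjoint T is orthogonal to ran T, hence to the closure of T D. -/
theorem coreMap_injective {T : H →L[ℂ] H} (hT : T† = T) (D : Submodule ℂ H) :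
    Function.Injective (coreMap T D : closedImage T D →ₗ[ℂ] H) := by
  rw [injective_iff_map_eq_zero]
  rintro ⟨x, hx⟩ hx0
  have hx0' : T x = 0 := hx0
  have h1 : x ∈ (D.map (T : H →ₗ[ℂ] H))ᗮ := by
    rw [Submodule.mem_orthogonal]
    rintro _ ⟨g, -, rfl⟩
    have := ContinuousLinearMap.adjoint_inner_right T g x
    rw [hT, hx0', inner_zero_right] at this
    exact this.symm
  rw [← Submodule.orthogonal_closure] at h1
  refine Subtype.ext ?_
  exact Submodule.disjoint_def.1 (Submodule.orthogonal_disjoint _) x hx h1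

/-- The Friedrichs extension in terms of the resolvent `T²` of an arbitrary extension. -/
theorem isFriedrichsExtension_relOf {S : Submodule ℂ (H × H)} {T : H →L[ℂ] H} (hT : T† = T)
    (hT1 : (1 - T ∘L T).IsPositive) (hS : S ≤ relOf (T ∘L T)) :
    IsFriedrichsExtension S
      (relOf (coreMap T (sumRange S) ∘L (coreMap T (sumRange S))†)) := by
  set D := sumRange S
  have hTn : ∀ x, ‖T x‖ ≤ ‖x‖ := norm_le_of_isPositive_one_sub (by rwa [hT])
  have hs : ∀ x y, inner ℂ (T x) y = inner ℂ x (T y) := fun x y ↦ by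
    rw [← ContinuousLinearMap.adjoint_inner_right, hT]
  have hC : ∀ x, ‖coreMap T D x‖ ≤ ‖x‖ := fun x ↦ hTn x
  have hinj := coreMap_injective hT D
  have hS1 : ∀ p ∈ S, T (T (p.1 + p.2)) = p.1 := fun p hp ↦ hS hp
  let h := formOf (coreMap T D) hinj hC
  have hdom : ∀ p ∈ S, p.1 ∈ h.domain := fun p hp ↦
    ⟨⟨T (p.1 + p.2), map_mem_closedImage T (add_mem_sumRange hp)⟩, hS1 p hp⟩
  have hinner : ∀ p ∈ S, ∀ q ∈ S,
      inner ℂ (T (p.1 + p.2)) (T (q.1 + q.2)) - inner ℂ p.1 q.1 = inner ℂ p.2 q.1 := by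
    intro p hp q hq
    rw [hs, hS1 q hq, inner_add_left]; ring
  refine ⟨isNonnegSelfAdjoint_relOf hC, h, ⟨formOf_isClosed, ?_, ?_⟩, formOf_isFormOf⟩
  · intro p hp q hq
    refine ⟨hdom p hp, hdom q hq, ?_⟩
    have := formOf_form (hinj := hinj) (hC := hC)
      ⟨T (p.1 + p.2), map_mem_closedImage T (add_mem_sumRange hp)⟩
      ⟨T (q.1 + q.2), map_mem_closedImage T (add_mem_sumRange hq)⟩ ⟨_, rfl⟩ ⟨_, rfl⟩
    simp only [coreMap_apply, hS1 p hp, hS1 q hq, Submodule.coe_inner] at this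
    rw [hinner p hp q hq] at this
    exact this
  · intro g hg hgS
    -- By `hinner`, ‖T g‖² with g = f + f' is the form of S at f plus ‖f‖². So convergence of T gₙ
    -- makes the corresponding fₙ Cauchy for any closed extension of that form, which therefore
    -- contains the limit T x.
    have approx : ∀ x : closedImage T D, ∃ p : ℕ → S, ∃ hx : T x ∈ g.domain,
        ∃ hp : ∀ n, (p n : H × H).1 ∈ g.domain,
        Tendsto (fun n ↦ T ((p n : H × H).1 + (p n : H × H).2)) atTop (𝓝 (x : H)) ∧
        Tendsto (fun n ↦ g.quad (⟨_, hp n⟩ - ⟨T x, hx⟩)) atTop (𝓝 0) := by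
      rintro ⟨x, hx⟩
      obtain ⟨w, hw, hlim⟩ := mem_closure_iff_seq_limit.1 (show x ∈ closure _ from hx)
      have : ∀ n, ∃ p : S, T ((p : H × H).1 + (p : H × H).2) = w n := by
        intro n
        obtain ⟨_, ⟨p, hp, rfl⟩, he⟩ := hw n
        exact ⟨⟨p, hp⟩, he⟩
      choose p hp using this
      have hpd : ∀ n, (p n : H × H).1 ∈ g.domain := fun n ↦ (hgS _ (p n).2 _ (p n).2).1
      have hlim' : Tendsto (fun n ↦ ((⟨_, hpd n⟩ : g.domain) : H)) atTop (𝓝 (T x)) := by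
        refine ((T.continuous.tendsto x).comp hlim).congr fun n ↦ ?_
        simp only [Function.comp_apply]
        rw [← hp, hS1 _ (p n).2]
      have hq : Tendsto (fun k : ℕ × ℕ ↦
          g.quad ((⟨_, hpd k.1⟩ : g.domain) - ⟨_, hpd k.2⟩)) atTop (𝓝 0) := by
        have hc := (cauchySeq_iff_tendsto_dist_atTop_0.1 hlim.cauchySeq).pow 2
        rw [zero_pow two_ne_zero] at hc
        refine squeeze_zero (fun _ ↦ g.quad_nonneg _) (fun k ↦ ?_) hc
        obtain ⟨h1, _, h2⟩ := hgS _ (p k.1 - p k.2).2 _ (p k.1 - p k.2).2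
        have h3 := hinner _ (p k.1 - p k.2).2 _ (p k.1 - p k.2).2
        have h4 : g.quad ((⟨_, hpd k.1⟩ : g.domain) - ⟨_, hpd k.2⟩) =
            (g.form ⟨_, h1⟩ ⟨_, h1⟩).re := rfl
        rw [h4, h2, ← h3, inner_self_eq_ofReal, inner_self_eq_ofReal, ← Complex.ofReal_sub,
          Complex.ofReal_re]
        have h5 : T ((p k.1 - p k.2 : S).1.1 + (p k.1 - p k.2 : S).1.2) = w k.1 - w k.2 := by
          rw [← hp, ← hp, ← map_sub]
          congr 1
          simp only [Submodule.coe_sub, Prod.fst_sub, Prod.snd_sub]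
          abel
        rw [h5, dist_eq_norm]
        nlinarith [sq_nonneg ‖(p k.1 - p k.2 : S).1.1‖]
      obtain ⟨hx', hlim''⟩ := hg _ _ hlim' hq
      exact ⟨p, hx', hpd, hlim.congr fun n ↦ (hp n).symm, hlim''⟩
    have hle : h.domain ≤ g.domain := by
      rintro _ ⟨x, rfl⟩
      obtain ⟨_, hx, _⟩ := approx x
      exact hx
    refine ⟨hle, ?_⟩
    rintro ⟨_, x, rfl⟩ ⟨_, y, rfl⟩
    refine (formOf_form (hinj := hinj) (hC := hC) x y ⟨_, rfl⟩ ⟨_, rfl⟩).trans ?_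
    obtain ⟨p, hx, hp, hpx, hpq⟩ := approx x
    obtain ⟨q, hy, hq, hqy, hqq⟩ := approx y
    have hl1 := g.tendsto_form hpq hqq
    refine tendsto_nhds_unique ?_ hl1
    have hl2 : Tendsto (fun n ↦ inner ℂ (T ((p n : H × H).1 + (p n : H × H).2))
        (T ((q n : H × H).1 + (q n : H × H).2)) -
        inner ℂ (T (T ((p n : H × H).1 + (p n : H × H).2)))
        (T (T ((q n : H × H).1 + (q n : H × H).2)))) atTop
        (𝓝 (inner ℂ (x : H) (y : H) - inner ℂ (T x) (T y))) :=
      (hpx.inner hqy).sub (((T.continuous.tendsto _).comp hpx).inner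
        ((T.continuous.tendsto _).comp hqy))
    refine hl2.congr fun n ↦ ?_
    obtain ⟨_, _, h2⟩ := hgS _ (p n).2 _ (q n).2
    rw [hS1 _ (p n).2, hS1 _ (q n).2, hinner _ (p n).2 _ (q n).2, ← h2]

end Forms

/-! ### From a splitting of the identity of the defect space to a special pair. -/

section SpecialPairs

variable {H : Type*} [NormedAddCommGroup H] [InnerProductSpace ℂ H] [CompleteSpace H]

theorem IsPositive.apply_eq_zero {X : H →L[ℂ] H} (hX : X.IsPositive) {g : H}
    (hg : (inner ℂ (X g) g).re = 0) : X g = 0 := by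
  obtain ⟨T, hT, hTX, -⟩ := IsPositive.exists_isSelfAdjoint_comp_self hX
  have h1 : inner ℂ (X g) g = inner ℂ (T g) (T g) := by
    rw [← hTX, ContinuousLinearMap.comp_apply]
    nth_rw 1 [← hT]
    rw [ContinuousLinearMap.adjoint_inner_left]
  rw [h1, inner_self_eq_ofReal, Complex.ofReal_re] at hg
  have h2 : T g = 0 := by simpa using hg
  rw [← hTX, ContinuousLinearMap.comp_apply, h2, map_zero]

theorem IsPositive.apply_eq_zero_of_add {X Y : H →L[ℂ] H} (hX : X.IsPositive) (hY : Y.IsPositive)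
    {g : H} (hg : (X + Y) g = 0) : X g = 0 := by
  refine IsPositive.apply_eq_zero hX (le_antisymm ?_ (hX.re_inner_nonneg_left g))
  have h1 : inner ℂ (X g) g + inner ℂ (Y g) g = 0 := by
    rw [← inner_add_left, ← add_apply, hg, inner_zero_left]
  have h2 := congrArg Complex.re h1
  have h3 : 0 ≤ (inner ℂ (Y g) g).re := hY.re_inner_nonneg_left g
  rw [Complex.add_re, Complex.zero_re] at h2
  linarith

/-- As T is selfadjoint, T w ⊥ D means w ⊥ T D, while w lies in the closure of T D. This separates
the ranges of A and B from D^⊥, where J takes its values. -/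
theorem coreMap_eq_zero_of_mem_orthogonal {T : H →L[ℂ] H} (hT : T† = T) {D : Submodule ℂ H}
    {w : closedImage T D} (hw : coreMap T D w ∈ Dᗮ) : w = 0 := by
  have h1 : (w : H) ∈ (D.map (T : H →ₗ[ℂ] H))ᗮ := by
    rw [Submodule.mem_orthogonal]
    rintro _ ⟨g, hg, rfl⟩
    have := Submodule.inner_right_of_mem_orthogonal hg hw
    rwa [coreMap_apply, ← ContinuousLinearMap.adjoint_inner_left, hT] at this
  rw [← Submodule.orthogonal_closure] at h1
  exact Subtype.ext (Submodule.disjoint_def.1 (Submodule.orthogonal_disjoint _) _ w.2 h1)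

theorem coreMap_comp_adjoint_apply {T : H →L[ℂ] H} (hT : T† = T) (D : Submodule ℂ H) (x : H) :
    (coreMap T D ∘L (coreMap T D)†) x = T ((closedImage T D).starProjection (T x)) := by
  rw [coreMap, ContinuousLinearMap.adjoint_comp, hT, Submodule.adjoint_subtypeL]
  rfl

theorem coreMap_comp_adjoint_apply_of_mem {T : H →L[ℂ] H} (hT : T† = T) {D : Submodule ℂ H}
    {g : H} (hg : g ∈ D) : (coreMap T D ∘L (coreMap T D)†) g = T (T g) := by
  rw [coreMap_comp_adjoint_apply hT,
    Submodule.starProjection_eq_self_iff.2 (map_mem_closedImage T hg)]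

/-- `C C*`, where `C` is the restriction of `T` to the closure of `T D`, is the smallest among the
nonnegative operators that agree with `T²` on `D`. -/
theorem isPositive_sub_coreMap {T X : H →L[ℂ] H} (hT : T† = T) {D : Submodule ℂ H}
    (hX : X.IsPositive) (hXD : ∀ g ∈ D, X g = T (T g)) :
    (X - coreMap T D ∘L (coreMap T D)†).IsPositive := by
  have hs : ∀ x y, inner ℂ (T x) y = inner ℂ x (T y) := fun x y ↦ by
    rw [← ContinuousLinearMap.adjoint_inner_right, hT]
  have hsymm : (X - coreMap T D ∘L (coreMap T D)†).IsSymmetric := by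
    refine LinearMap.IsSymmetric.sub hX.isSymmetric ?_
    exact (ContinuousLinearMap.isPositive_self_comp_adjoint (coreMap T D)).isSymmetric
  refine ⟨hsymm, fun x ↦ ?_⟩
  set P := (closedImage T D).starProjection
  -- X and T² agree on D, so passing from x to x - g with g in D does not change (Xx, x) - ‖Tx‖².
  -- Positivity of X at x - g gives the bound for y = T g, then for its limits; y = P T x is the
  -- optimal choice.
  have key : ∀ y ∈ closedImage T D, 0 ≤ (inner ℂ (X x) x).re - ‖T x‖ ^ 2 + ‖T x - y‖ ^ 2 := by
    intro y hy
    have hclosed : IsClosed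
        {y : H | 0 ≤ (inner ℂ (X x) x).re - ‖T x‖ ^ 2 + ‖T x - y‖ ^ 2} :=
      isClosed_le continuous_const (by fun_prop)
    refine hclosed.closure_subset_iff.2 ?_ (show y ∈ closure _ from hy)
    rintro _ ⟨g, hg, rfl⟩
    have h1 := hX.re_inner_nonneg_left (x - g)
    have h2 : inner ℂ (X (x - g)) (x - g) - inner ℂ (T (x - g)) (T (x - g)) =
        inner ℂ (X x) x - inner ℂ (T x) (T x) := by
      have h3 : inner ℂ (X x) g = inner ℂ x (T (T g)) := by
        rw [hX.inner_left_eq_inner_right, hXD g hg]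
      simp only [map_sub, inner_sub_left, inner_sub_right, h3, hXD g hg, hs]
      ring
    rw [inner_self_eq_ofReal, inner_self_eq_ofReal] at h2
    have h4 := congrArg Complex.re h2
    rw [Complex.sub_re, Complex.sub_re, Complex.ofReal_re, Complex.ofReal_re] at h4
    change 0 ≤ (inner ℂ (X x) x).re - ‖T x‖ ^ 2 + ‖T x - T g‖ ^ 2
    rw [← h4, ← map_sub, sub_add_cancel]
    exact h1
  have h5 := key (P (T x)) (Submodule.starProjection_apply_mem _ _)
  have h6 : inner ℂ ((coreMap T D ∘L (coreMap T D)†) x) x =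
      inner ℂ (T x) (T x) - inner ℂ (T x - P (T x)) (T x - P (T x)) := by
    rw [coreMap_comp_adjoint_apply hT, hs]
    have h7 : inner ℂ (T x - P (T x)) (P (T x)) = 0 :=
      Submodule.starProjection_inner_eq_zero _ _ (Submodule.starProjection_apply_mem _ _)
    rw [inner_sub_right, h7, sub_zero, inner_sub_left]
    ring
  change 0 ≤ (inner ℂ (X x - (coreMap T D ∘L (coreMap T D)†) x) x).re
  rw [inner_sub_left, h6, inner_self_eq_ofReal, inner_self_eq_ofReal, Complex.sub_re,
    Complex.sub_re, Complex.ofReal_re, Complex.ofReal_re]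
  linarith

/-- The identity is the sum of the resolvent of the Friedrichs extension of `S`, of the resolvent
of the Friedrichs extension of `S⁻¹`, and of an operator that lives on the defect space. -/
theorem exists_resolvent_decomposition {S : Submodule ℂ (H × H)} {R R' : H →L[ℂ] H}
    (hR : R.IsPositive) (hR1 : (1 - R).IsPositive) (hR' : R'.IsPositive)
    (hR1' : (1 - R').IsPositive) (hinf : relOf R ⊓ relOf R' = S) :
    ∃ T T' : H →L[ℂ] H, T† = T ∧ T'† = T' ∧ (1 - T ∘L T).IsPositive ∧
      (1 - T' ∘L T').IsPositive ∧ S ≤ relOf (T ∘L T) ∧ relInv S ≤ relOf (T' ∘L T') ∧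
      ∃ J : (sumRange S)ᗮ →L[ℂ] H, (∀ n, J n = 0 → n = 0) ∧ (∀ n, J n ∈ (sumRange S)ᗮ) ∧
        (∀ g, (J†) g = 0 ↔ g ∈ sumRange S) ∧
        coreMap T (sumRange S) ∘L (coreMap T (sumRange S))† + J ∘L J† +
          coreMap T' (sumRange S) ∘L (coreMap T' (sumRange S))† = 1 := by
  set D := sumRange S with hD
  have hSR : ∀ p ∈ S, R (p.1 + p.2) = p.1 := fun p hp ↦ (hinf.ge hp).1
  have hSR' : ∀ p ∈ S, R' (p.1 + p.2) = p.1 := fun p hp ↦ (hinf.ge hp).2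
  -- Disjointness enters here: equal values put {R g, g - R g} into both relations.
  have hRR' : ∀ g, R g = R' g → g ∈ D := by
    intro g hg
    have h1 : (R g, g - R g) ∈ S := by
      rw [← hinf]
      refine ⟨mk_mem_relOf R g, ?_⟩
      rw [hg]
      exact mk_mem_relOf R' g
    have := add_mem_sumRange h1
    rwa [add_sub_cancel] at this
  have hagree : ∀ g ∈ D, R' g = R g := by
    rintro _ ⟨p, hp, rfl⟩
    exact (hSR' p hp).trans (hSR p hp).symm
  obtain ⟨T, hT, hTR, -⟩ := IsPositive.exists_isSelfAdjoint_comp_self hR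
  obtain ⟨T', hT', hTR', -⟩ := IsPositive.exists_isSelfAdjoint_comp_self hR1
  have hTg : ∀ g, T (T g) = R g := fun g ↦ DFunLike.congr_fun hTR g
  have hTg' : ∀ g, T' (T' g) = g - R g := fun g ↦ DFunLike.congr_fun hTR' g
  set A := coreMap T D ∘L (coreMap T D)†
  set B := coreMap T' D ∘L (coreMap T' D)†
  have hA : (R - A).IsPositive := isPositive_sub_coreMap hT hR fun g _ ↦ (hTg g).symm
  have hB : (1 - R - B).IsPositive := isPositive_sub_coreMap hT' hR1 fun g _ ↦ (hTg' g).symm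
  have hA' : (R' - A).IsPositive :=
    isPositive_sub_coreMap hT hR' fun g hg ↦ by rw [hTg, hagree g hg]
  have hB' : (1 - R' - B).IsPositive :=
    isPositive_sub_coreMap hT' hR1' fun g hg ↦ by
      rw [hTg', ← hagree g hg]; rfl
  have hΔ : (1 - A - B).IsPositive := by
    convert hA.add hB using 1; abel
  obtain ⟨U, hU, hUU, -⟩ := IsPositive.exists_isSelfAdjoint_comp_self hΔ
  have hUs : ∀ x y, inner ℂ (U x) y = inner ℂ x (U y) := fun x y ↦ by
    rw [← ContinuousLinearMap.adjoint_inner_right, hU]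
  -- 1 - A - B is (R - A) + (1 - R - B), and likewise with R'. All summands are nonnegative, so a
  -- kernel vector satisfies R g = A g = R' g and lies in D. Conversely, A = R and B = 1 - R on D.
  have hUD : ∀ g, U g = 0 ↔ g ∈ D := by
    intro g
    constructor
    · intro hg
      have h0 : (1 - A - B) g = 0 := by
        rw [← hUU, ContinuousLinearMap.comp_apply, hg, map_zero]
      have h1 : (R - A) g = 0 := IsPositive.apply_eq_zero_of_add hA hB (by
        rw [← h0]; congr 1; abel)
      have h2 : (R' - A) g = 0 := IsPositive.apply_eq_zero_of_add hA' hB' (by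
        rw [← h0]; congr 1; abel)
      rw [sub_apply, sub_eq_zero] at h1 h2
      exact hRR' g (h1.trans h2.symm)
    · intro hg
      have h0 : inner ℂ (U g) (U g) = 0 := by
        rw [hUs, ← ContinuousLinearMap.comp_apply, hUU, sub_apply, sub_apply, one_apply_eq_self,
          coreMap_comp_adjoint_apply_of_mem hT hg, coreMap_comp_adjoint_apply_of_mem hT' hg,
          hTg, hTg', sub_self, inner_zero_right]
      exact inner_self_eq_zero.1 h0
  have hUmem : ∀ x, U x ∈ Dᗮ := by
    intro x
    rw [Submodule.mem_orthogonal]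
    intro g hg
    rw [← hUs, (hUD g).2 hg, inner_zero_left]
  let J : Dᗮ →L[ℂ] H := U ∘L Dᗮ.subtypeL
  have hJadj : ∀ g, ((J†) g : H) = U g := fun g ↦ by
    change (((U ∘L Dᗮ.subtypeL)†) g : H) = _
    rw [ContinuousLinearMap.adjoint_comp, hU, Submodule.adjoint_subtypeL]
    exact Submodule.starProjection_eq_self_iff.2 (hUmem g)
  refine ⟨T, T', hT, hT', hTR ▸ hR1, ?_, ?_, ?_, J, ?_, fun n ↦ hUmem n, ?_, ?_⟩
  · rw [hTR', sub_sub_cancel]; exact hR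
  · rw [hTR]; exact fun p hp ↦ hSR p hp
  · rw [hTR', ← relInv_relOf]
    exact fun p hp ↦ hSR (p.2, p.1) hp
  · intro n hn
    have h1 : (n : H) ∈ D := (hUD _).1 hn
    exact Subtype.ext (Submodule.disjoint_def.1 (Submodule.orthogonal_disjoint D) _ h1 n.2)
  · intro g
    rw [← hUD, ← hJadj, Submodule.coe_eq_zero]
  · have : J ∘L J† = 1 - A - B := by
      ext g
      rw [← hUU]
      exact congrArg U (hJadj g)
    rw [this]; abel

theorem comp_adjoint_eq_add {E G₀ G₁ G₂ : Type*}
    [NormedAddCommGroup E] [InnerProductSpace ℂ E] [CompleteSpace E]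
    [NormedAddCommGroup G₀] [InnerProductSpace ℂ G₀] [CompleteSpace G₀]
    [NormedAddCommGroup G₁] [InnerProductSpace ℂ G₁] [CompleteSpace G₁]
    [NormedAddCommGroup G₂] [InnerProductSpace ℂ G₂] [CompleteSpace G₂]
    {α : G₀ →L[ℂ] E} {μ : G₁ →L[ℂ] E} {η : G₂ →L[ℂ] E}
    (hone : α ∘L α† + μ ∘L μ† + η ∘L η† = 1) (J : E →L[ℂ] H) :
    J ∘L J† = (J ∘L α) ∘L (J ∘L α)† + (J ∘L μ) ∘L (J ∘L μ)† + (J ∘L η) ∘L (J ∘L η)† := by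
  ext g
  have h1 := congrArg J (DFunLike.congr_fun hone ((J†) g))
  simp only [ContinuousLinearMap.adjoint_comp, add_apply, ContinuousLinearMap.comp_apply,
    one_apply_eq_self, map_add] at h1 ⊢
  exact h1.symm

/-- A decomposition of the identity of the defect space yields a special pair. -/
theorem isSpecialPair_of_decomposition {S : Submodule ℂ (H × H)}
    {F K G₀ G₁ G₂ : Type*}
    [NormedAddCommGroup F] [InnerProductSpace ℂ F] [CompleteSpace F]
    [NormedAddCommGroup K] [InnerProductSpace ℂ K] [CompleteSpace K]
    [NormedAddCommGroup G₀] [InnerProductSpace ℂ G₀] [CompleteSpace G₀]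
    [NormedAddCommGroup G₁] [InnerProductSpace ℂ G₁] [CompleteSpace G₁]
    [NormedAddCommGroup G₂] [InnerProductSpace ℂ G₂] [CompleteSpace G₂]
    {A : F →L[ℂ] H} {B : K →L[ℂ] H} {J : (sumRange S)ᗮ →L[ℂ] H}
    (hsum : A ∘L A† + J ∘L J† + B ∘L B† = 1)
    (hA : ∀ w, A w ∈ (sumRange S)ᗮ → w = 0) (hB : ∀ w, B w ∈ (sumRange S)ᗮ → w = 0)
    (hJinj : ∀ n, J n = 0 → n = 0) (hJmem : ∀ n, J n ∈ (sumRange S)ᗮ)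
    (hJker : ∀ g, (J†) g = 0 ↔ g ∈ sumRange S) (hS : S ≤ relOf (A ∘L A†))
    {α : G₀ →L[ℂ] (sumRange S)ᗮ} {μ : G₁ →L[ℂ] (sumRange S)ᗮ} {η : G₂ →L[ℂ] (sumRange S)ᗮ}
    (hone : α ∘L α† + μ ∘L μ† + η ∘L η† = 1)
    (hαμ : ∀ x y, α x + μ y = 0 → x = 0 ∧ y = 0) (hμη : ∀ y z, μ y = η z → y = 0)
    (hμ : ∀ n, (μ†) n = 0 → n = 0) :
    IsSpecialPair S (relOf (A ∘L A† + (J ∘L α) ∘L (J ∘L α)†))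
      (relOf (A ∘L A† + (J ∘L α) ∘L (J ∘L α)† + (J ∘L μ) ∘L (J ∘L μ)†)) := by
  rw [← rowL2_comp_adjoint A (J ∘L α)]
  set C₀ := rowL2 A (J ∘L α)
  have hJJ := comp_adjoint_eq_add hone J
  have hsum' : C₀ ∘L C₀† + (J ∘L μ) ∘L (J ∘L μ)† +
      rowL2 B (J ∘L η) ∘L (rowL2 B (J ∘L η))† = 1 := by
    rw [rowL2_comp_adjoint, rowL2_comp_adjoint, ← hsum, hJJ]; abel
  have hker : ∀ x y, C₀ x + (J ∘L μ) y = 0 → x = 0 ∧ y = 0 := by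
    intro x y hxy
    have h1 : A x.fst + J (α x.snd + μ y) = 0 := by
      rw [map_add, ← add_assoc]; exact hxy
    have h2 : x.fst = 0 := hA _ (by
      rw [eq_neg_of_add_eq_zero_left h1]; exact neg_mem (hJmem _))
    rw [h2, map_zero, zero_add] at h1
    obtain ⟨h3, h4⟩ := hαμ _ _ (hJinj _ h1)
    exact ⟨WithLp.ofLp_injective 2 (Prod.ext h2 h3), h4⟩
  have hsing : ∀ y z, (J ∘L μ) y = rowL2 B (J ∘L η) z → y = 0 := by
    intro y z hyz
    have h1 : J (μ y) = B z.fst + J (η z.snd) := hyz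
    have h2 : z.fst = 0 := hB _ (by
      rw [← sub_eq_iff_eq_add.2 h1]; exact sub_mem (hJmem _) (hJmem _))
    rw [h2, map_zero, zero_add, ← sub_eq_zero, ← map_sub] at h1
    exact hμη _ _ (sub_eq_zero.1 (hJinj _ h1))
  obtain ⟨hs₀, hs₁, hforms⟩ := exists_form_restriction hsum' hker hsing
  have hval : ∀ g ∈ sumRange S, (C₀ ∘L C₀†) g = (A ∘L A†) g ∧ ((J ∘L μ) ∘L (J ∘L μ)†) g = 0 := by
    intro g hg
    have h1 := (hJker g).2 hg
    constructor
    · rw [rowL2_comp_adjoint]; simp [ContinuousLinearMap.adjoint_comp, h1]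
    · simp [ContinuousLinearMap.adjoint_comp, h1]
  have hS₀ : S ≤ relOf (C₀ ∘L C₀†) := fun p hp ↦ by
    rw [mem_relOf, (hval _ (add_mem_sumRange hp)).1]; exact hS hp
  have hS₁ : S ≤ relOf (C₀ ∘L C₀† + (J ∘L μ) ∘L (J ∘L μ)†) := fun p hp ↦ by
    rw [mem_relOf, add_apply, (hval _ (add_mem_sumRange hp)).2, add_zero]; exact hS₀ hp
  refine ⟨hs₀, hs₁, hS₀, hS₁, le_antisymm ?_ (le_inf hS₀ hS₁), hforms⟩
  rintro p ⟨hp₀, hp₁⟩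
  have hp₀' : (C₀ ∘L C₀†) (p.1 + p.2) = p.1 := hp₀
  have hp₁' : (C₀ ∘L C₀† + (J ∘L μ) ∘L (J ∘L μ)†) (p.1 + p.2) = p.1 := hp₁
  rw [add_apply, hp₀', add_eq_left] at hp₁'
  -- For a common element the two resolvents agree at p.1 + p.2, so μ*J* vanishes there. Injectivity
  -- of μ* and ker J* = D put p.1 + p.2 into D.
  have h1 : ((J ∘L μ)†) (p.1 + p.2) = 0 := by
    rw [← inner_self_eq_zero (𝕜 := ℂ), ContinuousLinearMap.adjoint_inner_left,
      ← ContinuousLinearMap.comp_apply, hp₁', inner_zero_right]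
  rw [ContinuousLinearMap.adjoint_comp] at h1
  obtain ⟨q, hq, hqp⟩ := (hJker _).1 (hμ _ h1)
  have hqp' : q.1 + q.2 = p.1 + p.2 := hqp
  have h2 : (C₀ ∘L C₀†) (q.1 + q.2) = q.1 := hS₀ hq
  rw [hqp', hp₀'] at h2
  have h3 : p = q := Prod.ext h2 (by rw [h2] at hqp'; exact (add_left_cancel hqp').symm)
  exact h3 ▸ hq

end SpecialPairs

/-! ### Operators on ℓ² whose ranges meet trivially, and the resulting splitting of the identity. -/

section OperatorRanges

/-- The Hilbert space of square summable sequences. -/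
abbrev L2Seq : Type := lp (fun _ : ℕ ↦ ℂ) 2

theorem norm_coeff_le (x : L2Seq) (n : ℕ) : ‖x n‖ ≤ ‖x‖ :=
  lp.norm_apply_le_norm two_ne_zero x n

theorem summable_half_pow : Summable fun n : ℕ ↦ (1 / 2 : ℝ) ^ (n + 1) :=
  (summable_nat_add_iff 1).2 summable_geometric_two

theorem tsum_half_pow : ∑' n : ℕ, (1 / 2 : ℝ) ^ (n + 1) = 1 := by
  simp_rw [pow_succ, tsum_mul_right, tsum_geometric_two]; norm_num

/-- The matrix entries are dominated by `2⁻ⁿ⁻¹ 2⁻ʲ⁻¹`. -/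
def IsDominated (m : ℕ → ℕ → ℝ) : Prop :=
  ∀ n j, |m n j| ≤ (1 / 2 : ℝ) ^ (n + 1) * (1 / 2 : ℝ) ^ (j + 1)

namespace IsDominated

variable {m : ℕ → ℕ → ℝ}

theorem norm_mul_le (hm : IsDominated m) (x : L2Seq) (n j : ℕ) :
    ‖(m n j : ℂ) * x j‖ ≤ (1 / 2 : ℝ) ^ (n + 1) * ‖x‖ * (1 / 2 : ℝ) ^ (j + 1) := by
  rw [norm_mul, Complex.norm_real, Real.norm_eq_abs, mul_right_comm]
  exact mul_le_mul (hm n j) (norm_coeff_le x j) (norm_nonneg _) (by positivity)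

theorem summable (hm : IsDominated m) (x : L2Seq) (n : ℕ) : Summable fun j ↦ (m n j : ℂ) * x j :=
  Summable.of_norm_bounded (summable_half_pow.mul_left _) (hm.norm_mul_le x n)

theorem norm_tsum_le (hm : IsDominated m) (x : L2Seq) (n : ℕ) :
    ‖∑' j, (m n j : ℂ) * x j‖ ≤ (1 / 2 : ℝ) ^ (n + 1) * ‖x‖ := by
  refine (tsum_of_norm_bounded (summable_half_pow.mul_left _).hasSum
    (hm.norm_mul_le x n)).trans ?_
  rw [tsum_mul_left, tsum_half_pow, mul_one]

theorem sq_norm_tsum_le (hm : IsDominated m) (x : L2Seq) (n : ℕ) :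
    ‖∑' j, (m n j : ℂ) * x j‖ ^ 2 ≤ (1 / 2 : ℝ) ^ (n + 1) * ‖x‖ ^ 2 := by
  refine (pow_le_pow_left₀ (norm_nonneg _) (hm.norm_tsum_le x n) 2).trans ?_
  rw [mul_pow]
  refine mul_le_mul_of_nonneg_right ?_ (sq_nonneg _)
  refine pow_le_of_le_one (by positivity) ?_ two_ne_zero
  exact pow_le_one₀ (by norm_num) (by norm_num)

theorem memℓp (hm : IsDominated m) (x : L2Seq) : Memℓp (fun n ↦ ∑' j, (m n j : ℂ) * x j) 2 := by
  refine memℓp_gen ?_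
  simp only [ENNReal.toReal_ofNat, Real.rpow_ofNat]
  exact Summable.of_nonneg_of_le (fun _ ↦ sq_nonneg _) (hm.sq_norm_tsum_le x)
    (summable_half_pow.mul_right _)

/-- The operator with the matrix `m`. -/
noncomputable def toCLM (hm : IsDominated m) : L2Seq →L[ℂ] L2Seq :=
  LinearMap.mkContinuous
    { toFun := fun x ↦ (⟨_, hm.memℓp x⟩ : L2Seq)
      map_add' := fun x y ↦ by
        ext n
        change ∑' j, (m n j : ℂ) * (x j + y j) = _ + _
        simp_rw [mul_add]
        exact (hm.summable x n).tsum_add (hm.summable y n)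
      map_smul' := fun c x ↦ by
        ext n
        change ∑' j, (m n j : ℂ) * (c * x j) = c * ∑' j, (m n j : ℂ) * x j
        simp_rw [mul_left_comm _ c, tsum_mul_left] }
    1 (fun x ↦ by
      rw [one_mul]
      refine abs_le_of_sq_le_sq' ?_ (norm_nonneg _) |>.2
      have h1 := lp.norm_rpow_eq_tsum (p := 2) (by norm_num) (⟨_, hm.memℓp x⟩ : L2Seq)
      simp only [ENNReal.toReal_ofNat, Real.rpow_ofNat] at h1
      refine h1.trans_le ?_
      have h2 := summable_half_pow.mul_right (‖x‖ ^ 2)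
      refine (Summable.tsum_le_tsum (hm.sq_norm_tsum_le x) ?_ h2).trans ?_
      · exact Summable.of_nonneg_of_le (fun _ ↦ sq_nonneg _) (hm.sq_norm_tsum_le x) h2
      · rw [tsum_mul_right, tsum_half_pow, one_mul])

theorem toCLM_apply (hm : IsDominated m) (x : L2Seq) (n : ℕ) : hm.toCLM x n = ∑' j, (m n j : ℂ) * x j := rfl

theorem norm_toCLM_le (hm : IsDominated m) (x : L2Seq) : ‖hm.toCLM x‖ ≤ ‖x‖ := by
  refine (ContinuousLinearMap.le_of_opNorm_le _ (LinearMap.mkContinuous_norm_le _ zero_le_one _) x).trans ?_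
  rw [one_mul]

theorem adjoint_toCLM (hm : IsDominated m) (hsymm : ∀ n j, m n j = m j n) : (hm.toCLM)† = hm.toCLM := by
  refine ((ContinuousLinearMap.eq_adjoint_iff _ _).2 fun x y ↦ ?_).symm
  rw [lp.inner_eq_tsum, lp.inner_eq_tsum]
  have hsum : Summable (Function.uncurry fun n j ↦
      starRingEnd ℂ ((m n j : ℂ) * x j) * y n) := by
    have h1 := (Summable.mul_of_nonneg (summable_half_pow.mul_right ‖y‖)
      (summable_half_pow.mul_right ‖x‖) (fun _ ↦ by positivity) (fun _ ↦ by positivity))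
    refine Summable.of_norm_bounded h1 ?_
    rintro ⟨n, j⟩
    simp only [Function.uncurry_apply_pair]
    rw [norm_mul, RCLike.norm_conj]
    refine (mul_le_mul (hm.norm_mul_le x n j) (norm_coeff_le y n) (norm_nonneg _)
      (by positivity)).trans (le_of_eq ?_)
    ring
  calc ∑' n, inner ℂ (hm.toCLM x n) (y n)
      = ∑' n, ∑' j, starRingEnd ℂ ((m n j : ℂ) * x j) * y n := by
        refine tsum_congr fun n ↦ ?_
        rw [RCLike.inner_apply', toCLM_apply, Complex.conj_tsum, tsum_mul_right]
    _ = ∑' j, ∑' n, starRingEnd ℂ ((m n j : ℂ) * x j) * y n := hsum.tsum_comm.symm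
    _ = ∑' j, inner ℂ (x j) (hm.toCLM y j) := by
        refine tsum_congr fun j ↦ ?_
        rw [RCLike.inner_apply', toCLM_apply, ← tsum_mul_left]
        refine tsum_congr fun n ↦ ?_
        rw [map_mul, Complex.conj_ofReal, hsymm n j]
        ring

end IsDominated

theorem isDominated_quarter_pow : IsDominated fun n j ↦ (1 / 4 : ℝ) ^ ((n + 1) * (j + 1)) := by
  intro n j
  beta_reduce
  rw [abs_of_nonneg (by positivity), ← pow_add, show (1 / 4 : ℝ) = (1 / 2) ^ 2 by norm_num,
    ← pow_mul]
  exact pow_le_pow_of_le_one (by norm_num) (by norm_num) (by nlinarith)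

theorem isDominated_diagonal :
    IsDominated fun n j ↦ if n = j then (1 / 4 : ℝ) ^ ((n + 1) * (n + 1)) else 0 := by
  intro n j
  beta_reduce
  split_ifs with h
  · subst h
    exact isDominated_quarter_pow n n
  · rw [abs_zero]; positivity

/-- A square summable sequence whose generating function decays faster than every power along
`4⁻ⁿ` vanishes. -/
theorem eq_zero_of_tsum_quarter_pow_eq {x y : L2Seq}
    (h : ∀ n : ℕ, ∑' j, (((1 / 4 : ℝ) ^ ((n + 1) * (j + 1)) : ℝ) : ℂ) * x j =
      (((1 / 4 : ℝ) ^ ((n + 1) * (n + 1)) : ℝ) : ℂ) * y n) : x = 0 := by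
  have hx : ∀ j, x j = 0 := by
    intro j
    induction j using Nat.strong_induction_on with
    | _ j ih =>
    -- The n-th equation with n = j + p evaluates the generating function at s = 4⁻ⁿ⁻¹. With the
    -- coefficients below j gone, division by s^(j+1) leaves s^p y(j + p) on the right; letting p →
    -- ∞ isolates x j.
    let s : ℕ → ℂ := fun p ↦ (1 / 4 : ℂ) ^ (j + p + 1)
    have hs : ∀ p, s p ≠ 0 := fun p ↦ pow_ne_zero _ (by norm_num)
    have hsn : ∀ p, ‖s p‖ = (1 / 4 : ℝ) ^ (j + p + 1) := fun p ↦ by simp [s]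
    have hs0 : Tendsto s atTop (𝓝 0) := by
      have h1 : Tendsto (fun n : ℕ ↦ (1 / 4 : ℂ) ^ n) atTop (𝓝 0) :=
        tendsto_pow_atTop_nhds_zero_of_norm_lt_one (by norm_num)
      refine (h1.comp (tendsto_add_atTop_nat (j + 1))).congr fun p ↦ ?_
      simp only [s, Function.comp_apply]
      congr 1; omega
    have hsle : ∀ p, ‖s p‖ ≤ 1 / 4 := fun p ↦ by
      rw [hsn]; exact pow_le_of_le_one (by norm_num) (by norm_num) (by omega)
    have key : ∀ p, ∑' k, x (k + j) * s p ^ k = s p ^ p * y (j + p) := by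
      intro p
      have h1 := h (j + p)
      have h2 := isDominated_quarter_pow.summable x (j + p)
      rw [← h2.sum_add_tsum_nat_add j, Finset.sum_eq_zero (fun i hi ↦ by
        rw [ih i (Finset.mem_range.1 hi), mul_zero]), zero_add] at h1
      have h3 : ∀ k, (((1 / 4 : ℝ) ^ ((j + p + 1) * (k + j + 1)) : ℝ) : ℂ) * x (k + j) =
          s p ^ (j + 1) * (x (k + j) * s p ^ k) := by
        intro k
        push_cast
        simp only [s]
        rw [pow_mul]
        ring
      have h4 : (((1 / 4 : ℝ) ^ ((j + p + 1) * (j + p + 1)) : ℝ) : ℂ) * y (j + p) =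
          s p ^ (j + 1) * (s p ^ p * y (j + p)) := by
        push_cast
        simp only [s]
        rw [pow_mul]
        ring
      rw [h4, tsum_congr h3, tsum_mul_left] at h1
      exact mul_left_cancel₀ (pow_ne_zero _ (hs p)) h1
    have hl : Tendsto (fun p ↦ ∑' k, x (k + j) * s p ^ k) atTop
        (𝓝 (∑' k, x (k + j) * 0 ^ k)) := by
      refine tendsto_tsum_of_dominated_convergence (bound := fun k ↦ ‖x‖ * (1 / 4 : ℝ) ^ k)
        ((summable_geometric_of_lt_one (by norm_num) (by norm_num)).mul_left _)
        (fun k ↦ (hs0.pow k).const_mul _) (Eventually.of_forall fun p k ↦ ?_)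
      rw [norm_mul, norm_pow]
      exact mul_le_mul (norm_coeff_le x _) (pow_le_pow_left₀ (norm_nonneg _) (hsle p) k)
        (by positivity) (norm_nonneg _)
    have hr : Tendsto (fun p ↦ s p ^ p * y (j + p)) atTop (𝓝 0) := by
      have h1 : Tendsto (fun p ↦ ‖s p‖ * ‖y‖) atTop (𝓝 0) := by
        simpa using hs0.norm.mul_const ‖y‖
      refine squeeze_zero_norm' ?_ h1
      filter_upwards [eventually_ge_atTop 1] with p hp
      rw [norm_mul, norm_pow]
      refine mul_le_mul ?_ (norm_coeff_le y _) (norm_nonneg _) (norm_nonneg _)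
      exact pow_le_of_le_one (norm_nonneg _) ((hsle p).trans (by norm_num)) (by omega)
    have h0 : ∑' k, x (k + j) * 0 ^ k = 0 :=
      tendsto_nhds_unique hl (hr.congr fun p ↦ (key p).symm)
    rw [tsum_eq_single 0 (fun k hk ↦ by rw [zero_pow hk, mul_zero])] at h0
    simpa using h0
  ext j
  exact hx j

/-- There are two selfadjoint contractions with trivial kernels, hence dense ranges, whose ranges
have trivial intersection. -/
theorem exists_ranges_disjoint : ∃ a₁ a₂ : L2Seq →L[ℂ] L2Seq, a₁† = a₁ ∧ a₂† = a₂ ∧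
    (∀ x, ‖a₁ x‖ ≤ ‖x‖) ∧ (∀ x, ‖a₂ x‖ ≤ ‖x‖) ∧ (∀ x, a₁ x = 0 → x = 0) ∧
    (∀ x, a₂ x = 0 → x = 0) ∧ ∀ x y, a₁ x = a₂ y → a₁ x = 0 := by
  have ha₁ : ∀ (x : L2Seq) n, isDominated_diagonal.toCLM x n =
      (((1 / 4 : ℝ) ^ ((n + 1) * (n + 1)) : ℝ) : ℂ) * x n := by
    intro x n
    rw [IsDominated.toCLM_apply, tsum_eq_single n (fun j hj ↦ by simp [hj.symm])]
    simp
  have hinj : ∀ x y : L2Seq, isDominated_diagonal.toCLM x = isDominated_quarter_pow.toCLM y →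
      y = 0 := by
    intro x y hxy
    refine eq_zero_of_tsum_quarter_pow_eq (y := x) fun n ↦ ?_
    rw [← ha₁, hxy, IsDominated.toCLM_apply]
  refine ⟨isDominated_diagonal.toCLM, isDominated_quarter_pow.toCLM,
    isDominated_diagonal.adjoint_toCLM fun n j ↦ ?_, isDominated_quarter_pow.adjoint_toCLM
      fun n j ↦ by rw [mul_comm], isDominated_diagonal.norm_toCLM_le,
    isDominated_quarter_pow.norm_toCLM_le, fun x hx ↦ ?_, fun y hy ↦ ?_, fun x y hxy ↦ ?_⟩
  · by_cases h : n = j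
    · subst h; rfl
    · rw [if_neg h, if_neg (Ne.symm h)]
  · ext n
    have h1 := ha₁ x n
    rw [hx] at h1
    have h2 : (((1 / 4 : ℝ) ^ ((n + 1) * (n + 1)) : ℝ) : ℂ) ≠ 0 := by
      push_cast; exact pow_ne_zero _ (by norm_num)
    exact (mul_eq_zero.1 h1.symm).resolve_left h2
  · exact hinj 0 y (by rw [hy, map_zero])
  · rw [hxy, hinj x y hxy, map_zero]

variable {E : Type*} [NormedAddCommGroup E] [InnerProductSpace ℂ E]

/-- Orthonormal vectors have mutual distance √2 > 1, so balls of radius 1/2 around them are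
disjoint. -/
theorem Orthonormal.countable_of_separable [TopologicalSpace.SeparableSpace E] {ι : Type*}
    {v : ι → E} (hv : Orthonormal ℂ v) : Countable ι := by
  refine Pairwise.countable_of_isOpen_disjoint (s := fun i ↦ Metric.ball (v i) (1 / 2))
    (fun i j hij ↦ ?_) (fun _ ↦ Metric.isOpen_ball)
    (fun i ↦ Metric.nonempty_ball.2 (by norm_num))
  refine Metric.ball_disjoint_ball ?_
  rw [dist_eq_norm]
  have h1 : ‖v i - v j‖ ^ 2 = 2 := by
    rw [norm_sub_sq (𝕜 := ℂ), hv.2 hij, hv.1, hv.1]; norm_num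
  nlinarith [norm_nonneg (v i - v j)]

theorem exists_hilbertBasis_sum [CompleteSpace E] [TopologicalSpace.SeparableSpace E]
    (hE : ¬ FiniteDimensional ℂ E) : Nonempty (HilbertBasis (ℕ ⊕ ℕ) ℂ E) := by
  obtain ⟨w, b, -⟩ := exists_hilbertBasis ℂ E
  have hc : Countable w := Orthonormal.countable_of_separable b.orthonormal
  have hi : Infinite w := by
    by_contra hfin
    rw [not_infinite_iff_finite] at hfin
    have := Fintype.ofFinite w
    exact hE b.toOrthonormalBasis.toBasis.finiteDimensional_of_finite
  obtain ⟨e⟩ : Nonempty (ℕ ⊕ ℕ ≃ w) := nonempty_equiv_of_countable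
  refine ⟨HilbertBasis.mk (b.orthonormal.comp e e.injective) ?_⟩
  rw [Set.range_comp, e.surjective.range_eq, Set.image_univ, b.dense_span]

/-- An infinite-dimensional separable Hilbert space is the orthogonal sum of two copies of `ℓ²`. -/
theorem exists_isometries [CompleteSpace E] [TopologicalSpace.SeparableSpace E]
    (hE : ¬ FiniteDimensional ℂ E) : ∃ V₁ V₂ : L2Seq →L[ℂ] E,
      (∀ x, (V₁†) (V₁ x) = x) ∧ (∀ x, (V₂†) (V₂ x) = x) ∧ (∀ x, (V₁†) (V₂ x) = 0) ∧
      (∀ x, (V₂†) (V₁ x) = 0) ∧ ∀ x, V₁ ((V₁†) x) + V₂ ((V₂†) x) = x := by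
  obtain ⟨b⟩ := exists_hilbertBasis_sum hE
  have o₁ := (b.orthonormal.comp Sum.inl Sum.inl_injective).orthogonalFamily
  have o₂ := (b.orthonormal.comp Sum.inr Sum.inr_injective).orthogonalFamily
  let V₁ := o₁.linearIsometry.toContinuousLinearMap
  let V₂ := o₂.linearIsometry.toContinuousLinearMap
  have hV₁ : ∀ x y, inner ℂ (V₁ x) (V₁ y) = inner ℂ x y := o₁.linearIsometry.inner_map_map
  have hV₂ : ∀ x y, inner ℂ (V₂ x) (V₂ y) = inner ℂ x y := o₂.linearIsometry.inner_map_map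
  have hs₁ : ∀ x : L2Seq, HasSum (fun i ↦ x i • b (Sum.inl i)) (V₁ x) := fun x ↦
    o₁.hasSum_linearIsometry x
  have hs₂ : ∀ x : L2Seq, HasSum (fun i ↦ x i • b (Sum.inr i)) (V₂ x) := fun x ↦
    o₂.hasSum_linearIsometry x
  have he₁ : ∀ i, V₁ (lp.single 2 i 1) = b (Sum.inl i) := fun i ↦ by
    refine (o₁.linearIsometry_apply_single (i := i) 1).trans ?_
    simp
  have he₂ : ∀ i, V₂ (lp.single 2 i 1) = b (Sum.inr i) := fun i ↦ by
    refine (o₂.linearIsometry_apply_single (i := i) 1).trans ?_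
    simp
  have hcross : ∀ x y, inner ℂ (V₁ x) (V₂ y) = 0 := by
    intro x y
    have h1 : ∀ i, inner ℂ (b (Sum.inl i)) (V₂ y) = 0 := fun i ↦ by
      have := (hs₂ y).mapL (innerSL ℂ (b (Sum.inl i)))
      refine this.unique ?_
      convert hasSum_zero with j
      simp only [innerSL_apply_apply, inner_smul_right]
      rw [b.orthonormal.2 (by simp), mul_zero]
    have := (hs₁ x).mapL (innerSL ℂ (V₂ y))
    rw [← inner_conj_symm, map_eq_zero]
    refine this.unique ?_
    convert hasSum_zero with j
    simp only [innerSL_apply_apply, inner_smul_right]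
    rw [← inner_conj_symm, h1, map_zero, mul_zero]
  have h11 : ∀ x, (V₁†) (V₁ x) = x := fun x ↦ ext_inner_right ℂ fun y ↦ by
    rw [ContinuousLinearMap.adjoint_inner_left, hV₁]
  have h22 : ∀ x, (V₂†) (V₂ x) = x := fun x ↦ ext_inner_right ℂ fun y ↦ by
    rw [ContinuousLinearMap.adjoint_inner_left, hV₂]
  have h12 : ∀ x, (V₁†) (V₂ x) = 0 := fun x ↦ ext_inner_left ℂ fun y ↦ by
    rw [ContinuousLinearMap.adjoint_inner_right, hcross, inner_zero_right]
  have h21 : ∀ x, (V₂†) (V₁ x) = 0 := fun x ↦ ext_inner_right ℂ fun y ↦ by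
    rw [ContinuousLinearMap.adjoint_inner_left, hcross, inner_zero_left]
  refine ⟨V₁, V₂, h11, h22, h12, h21, fun x ↦ ?_⟩
  rw [← sub_eq_zero]
  refine b.repr.map_eq_zero_iff.1 ?_
  ext i
  rw [b.repr_apply_apply]
  rcases i with i | i
  · rw [← he₁, ← ContinuousLinearMap.adjoint_inner_right, map_sub, map_add, h11, h12, add_zero,
      sub_self, inner_zero_right]; rfl
  · rw [← he₂, ← ContinuousLinearMap.adjoint_inner_right, map_sub, map_add, h21, h22, zero_add,
      sub_self, inner_zero_right]; rfl

/-- The operator c is the square root of (1 - a²)/2; the half is there because c enters both α and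
η. -/
theorem exists_sqrt_half_one_sub_sq [CompleteSpace E] {a : E →L[ℂ] E} (ha : a† = a)
    (han : ∀ x, ‖a x‖ ≤ ‖x‖) : ∃ c : E →L[ℂ] E, c† = c ∧ (∀ x, c (a x) = a (c x)) ∧
      ∀ x, c (c x) + c (c x) + a (a x) = x := by
  have hpos : (1 - a ∘L a).IsPositive := by
    have hsa : IsSelfAdjoint (1 - a ∘L a) := by
      rw [ContinuousLinearMap.isSelfAdjoint_iff', map_sub, ContinuousLinearMap.adjoint_comp, ha,
        ContinuousLinearMap.adjoint_one]
    refine ⟨hsa.isSymmetric, fun x ↦ ?_⟩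
    have h1 : inner ℂ ((1 - a ∘L a) x) x = inner ℂ x x - inner ℂ (a x) (a x) := by
      rw [sub_apply, one_apply_eq_self, inner_sub_left, ContinuousLinearMap.comp_apply]
      nth_rw 1 [← ha]
      rw [ContinuousLinearMap.adjoint_inner_left]
    change 0 ≤ (inner ℂ ((1 - a ∘L a) x) x).re
    rw [h1, inner_self_eq_ofReal, inner_self_eq_ofReal, ← Complex.ofReal_sub, Complex.ofReal_re,
      sub_nonneg]
    exact pow_le_pow_left₀ (norm_nonneg _) (han x) 2
  have hpos' : ((1 / 2 : ℂ) • (1 - a ∘L a)).IsPositive := hpos.smul_of_nonneg (by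
    rw [show (1 / 2 : ℂ) = ((1 / 2 : ℝ) : ℂ) by norm_num, Complex.zero_le_real]; norm_num)
  obtain ⟨c, hc, hcc, hcomm⟩ := IsPositive.exists_isSelfAdjoint_comp_self hpos'
  have hca : Commute c a := hcomm a (by
    refine Commute.smul_left (Commute.sub_left (Commute.one_left a) ?_) _
    exact (Commute.refl a).mul_left (Commute.refl a))
  refine ⟨c, hc, fun x ↦ DFunLike.congr_fun hca x, fun x ↦ ?_⟩
  have h1 : c (c x) = (1 / 2 : ℂ) • (x - a (a x)) := DFunLike.congr_fun hcc x
  rw [h1]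
  module

/-- The identity of an infinite-dimensional separable Hilbert space is a sum
`α α* + μ μ* + η η*` such that `μ` has dense range and the range of `μ` meets the ranges of `α`
and of `η` trivially. -/
theorem exists_one_decomposition [CompleteSpace E] [TopologicalSpace.SeparableSpace E]
    (hE : ¬ FiniteDimensional ℂ E) :
    ∃ (α : L2Seq →L[ℂ] E) (μ : WithLp 2 (L2Seq × L2Seq) →L[ℂ] E) (η : L2Seq →L[ℂ] E),
      α ∘L α† + μ ∘L μ† + η ∘L η† = 1 ∧ (∀ x y, α x + μ y = 0 → x = 0 ∧ y = 0) ∧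
      (∀ y z, μ y = η z → y = 0) ∧ ∀ n, (μ†) n = 0 → n = 0 := by
  obtain ⟨V₁, V₂, h11, h22, h12, h21, hV⟩ := exists_isometries hE
  obtain ⟨a₁, a₂, ha₁, ha₂, hn₁, hn₂, hi₁, hi₂, hdisj⟩ := exists_ranges_disjoint
  obtain ⟨c₁, hc₁, hca₁, hone₁⟩ := exists_sqrt_half_one_sub_sq ha₁ hn₁
  obtain ⟨c₂, hc₂, hca₂, hone₂⟩ := exists_sqrt_half_one_sub_sq ha₂ hn₂
  have hsplit : ∀ p q, V₁ p + V₂ q = 0 → p = 0 ∧ q = 0 := by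
    intro p q h
    have e1 := congrArg (V₁†) h
    have e2 := congrArg (V₂†) h
    rw [map_add, h11, h12, add_zero, map_zero] at e1
    rw [map_add, h21, h22, zero_add, map_zero] at e2
    exact ⟨e1, e2⟩
  -- Inserting c₁ x = a₁ p into x = 2c₁²x + a₁²x and commuting c₁ with a₁ shows x ∈ ran a₁. Likewise
  -- x ∈ ran a₂, so x = 0.
  have hz : ∀ x p q, c₁ x = a₁ p → c₂ x = a₂ q → x = 0 ∧ p = 0 ∧ q = 0 := by
    intro x p q hp hq
    have e1 : a₁ (c₁ p + c₁ p + a₁ x) = x := by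
      conv_rhs => rw [← hone₁ x, hp, hca₁]
      simp only [map_add]
    have e2 : a₂ (c₂ q + c₂ q + a₂ x) = x := by
      conv_rhs => rw [← hone₂ x, hq, hca₂]
      simp only [map_add]
    have e3 := hdisj _ _ (e1.trans e2.symm)
    rw [e1] at e3
    subst e3
    rw [map_zero] at hp hq
    exact ⟨rfl, hi₁ p hp.symm, hi₂ q hq.symm⟩
  -- The opposite signs in α and η cancel the cross terms between the two copies of ℓ² in α α* + η
  -- η*.
  refine ⟨V₁ ∘L c₁ + V₂ ∘L c₂, rowL2 (V₁ ∘L a₁) (V₂ ∘L a₂), V₁ ∘L c₁ - V₂ ∘L c₂, ?_, ?_, ?_, ?_⟩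
  · rw [rowL2_comp_adjoint]
    ext x
    simp only [map_add, map_sub, ContinuousLinearMap.adjoint_comp, hc₁, hc₂, ha₁, ha₂,
      add_apply, sub_apply, ContinuousLinearMap.comp_apply, one_apply_eq_self]
    have e1 := congrArg V₁ (hone₁ ((V₁†) x))
    have e2 := congrArg V₂ (hone₂ ((V₂†) x))
    simp only [map_add] at e1 e2
    conv_rhs => rw [← hV x, ← e1, ← e2]
    abel
  · intro x y h
    have h' : V₁ (c₁ x + a₁ y.fst) + V₂ (c₂ x + a₂ y.snd) = 0 := by
      rw [← h]
      simp only [rowL2_apply, add_apply, ContinuousLinearMap.comp_apply, map_add]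
      abel
    obtain ⟨e1, e2⟩ := hsplit _ _ h'
    obtain ⟨e3, e4, e5⟩ := hz x (-y.fst) (-y.snd)
      (by rw [map_neg]; exact eq_neg_of_add_eq_zero_left e1)
      (by rw [map_neg]; exact eq_neg_of_add_eq_zero_left e2)
    exact ⟨e3, WithLp.ofLp_injective 2 (Prod.ext (neg_eq_zero.1 e4) (neg_eq_zero.1 e5))⟩
  · intro y z h
    have h' : V₁ (c₁ z - a₁ y.fst) + V₂ (-(c₂ z) - a₂ y.snd) = 0 := by
      have h2 := sub_eq_zero.2 h.symm
      rw [← h2]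
      simp only [rowL2_apply, sub_apply, ContinuousLinearMap.comp_apply, map_sub, map_neg]
      abel
    obtain ⟨e1, e2⟩ := hsplit _ _ h'
    obtain ⟨e3, e4, e5⟩ := hz z y.fst (-y.snd) (sub_eq_zero.1 e1)
      (by rw [map_neg, ← sub_eq_zero.1 e2, neg_neg])
    exact WithLp.ofLp_injective 2 (Prod.ext e4 (neg_eq_zero.1 e5))
  · intro n hn
    rw [rowL2_adjoint_apply, ContinuousLinearMap.adjoint_comp, ContinuousLinearMap.adjoint_comp,
      ha₁, ha₂] at hn
    have e1 : (V₁†) n = 0 := hi₁ _ (congrArg (fun z ↦ z.fst) hn)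
    have e2 : (V₂†) n = 0 := hi₂ _ (congrArg (fun z ↦ z.snd) hn)
    rw [← hV n, e1, e2, map_zero, map_zero, add_zero]

end OperatorRanges

/-! ### Infinite defect numbers and the final choice of splittings. -/

section Conclusion

variable {H : Type*} [NormedAddCommGroup H] [InnerProductSpace ℂ H] [CompleteSpace H]

theorem eq_zero_of_comp_adjoint_apply_eq_zero {G : Type*} [NormedAddCommGroup G]
    [InnerProductSpace ℂ G] [CompleteSpace G] {C : G →L[ℂ] H} (h : ∀ g, (C ∘L C†) g = 0) :
    C = 0 := by
  have h1 : C† = 0 := by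
    ext g
    rw [zero_apply, ← inner_self_eq_zero (𝕜 := ℂ), ContinuousLinearMap.adjoint_inner_left]
    exact (congrArg (inner ℂ g) (h g)).trans (inner_zero_right g)
  rw [← ContinuousLinearMap.adjoint_adjoint C, h1, map_zero]

/-- If the defect number at `i` is infinite, then so is the defect number at `-1`. -/
theorem not_finiteDimensional_of_defectNumber {S : Submodule ℂ (H × H)} {R : H →L[ℂ] H}
    (hR : R.IsPositive) (hS : S ≤ relOf R) (h : defectNumber S Complex.I = ⊤) :
    ¬ FiniteDimensional ℂ (sumRange S)ᗮ := by
  intro hfin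
  -- Formally X = (Ã - i)(Ã + 1)⁻¹ for the relation Ã with resolvent R; it carries the defect space
  -- at i into that at -1.
  let X : H →ₗ[ℂ] H := LinearMap.id - (1 + Complex.I) • (R : H →ₗ[ℂ] H)
  have hX : ∀ u, X u = u - (1 + Complex.I) • R u := fun u ↦ rfl
  have hmem : ∀ u ∈ defectSubspace S Complex.I, X u ∈ (sumRange S)ᗮ := by
    intro u hu
    rw [Submodule.mem_orthogonal]
    rintro _ ⟨p, hp, rfl⟩
    have h1 : inner ℂ (p.2 - starRingEnd ℂ Complex.I • p.1) u = 0 := hu _ ⟨p, hp, rfl⟩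
    have h2 : R (p.1 + p.2) = p.1 := hS hp
    change inner ℂ (p.1 + p.2) (X u) = 0
    rw [hX, inner_sub_right, inner_smul_right, ← hR.inner_left_eq_inner_right, h2, ← h1]
    simp only [inner_add_left, inner_sub_left, inner_smul_left, Complex.conj_conj]
    ring
  -- X u = 0 gives (R u, u) = (1 + i)‖R u‖², which is real only if R u = 0.
  have hinj : ∀ u, X u = 0 → u = 0 := by
    intro u hu
    rw [hX, sub_eq_zero] at hu
    have h1 : inner ℂ (R u) u = (1 + Complex.I) * ((‖R u‖ ^ 2 : ℝ) : ℂ) := by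
      conv_lhs => rw [hu]
      rw [← inner_self_eq_ofReal, ← inner_smul_right, ← hu]
    have h2 := hR.inner_nonneg_left u
    rw [h1, Complex.le_def] at h2
    have h3 : ‖R u‖ ^ 2 = 0 := by
      have := h2.2
      rw [Complex.im_mul_ofReal, Complex.add_im, Complex.one_im, Complex.I_im, zero_add,
        one_mul] at this
      exact this.symm
    have h4 : R u = 0 := by simpa using h3
    rw [hu, h4, smul_zero]
  have hfin' : FiniteDimensional ℂ (defectSubspace S Complex.I) := by
    refine FiniteDimensional.of_injective (X.restrict hmem) ?_
    rw [injective_iff_map_eq_zero]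
    intro u hu
    exact Subtype.ext (hinj _ (congrArg Subtype.val hu))
  rw [defectNumber, Cardinal.toENat_eq_top] at h
  exact absurd (Module.rank_lt_aleph0 ℂ (defectSubspace S Complex.I)) (not_lt.2 h)

end Conclusion

end NonnegExt

open scoped InnerProduct in
open NonnegExt in
theorem corollary4p3 {H : Type*} [NormedAddCommGroup H] [InnerProductSpace ℂ H]
    [CompleteSpace H] [TopologicalSpace.SeparableSpace H]
    (S : H →ₗ.[ℂ] H) (hclosed : S.IsClosed)
    (hsymm : NonnegExt.IsSymm S.graph) (hnonneg : NonnegExt.IsNonneg S.graph)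
    (hdisj : ∃ A₀ A₁ : H →ₗ.[ℂ] H,
      NonnegExt.IsNonnegSelfAdjoint A₀.graph ∧ NonnegExt.IsNonnegSelfAdjoint A₁.graph ∧
      S ≤ A₀ ∧ S ≤ A₁ ∧ A₀.graph ⊓ A₁.graph = S.graph) :
    (∃ S₀ S₁ : Submodule ℂ (H × H), NonnegExt.IsSpecialPair S.graph S₀ S₁) ∧
    (NonnegExt.defectNumber S.graph Complex.I = ⊤ →
      NonnegExt.defectNumber S.graph (-Complex.I) = ⊤ →
      ∃ S₀ S₁ SF SK : Submodule ℂ (H × H),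
        NonnegExt.IsSpecialPair S.graph S₀ S₁ ∧
        NonnegExt.IsFriedrichsExtension S.graph SF ∧
        NonnegExt.IsKreinExtension S.graph SK ∧
        ({S₀, S₁} : Set (Submodule ℂ (H × H))) ≠ {SF, SK}) := by
  obtain ⟨A₀, A₁, h₀, h₁, -, -, hinf⟩ := hdisj
  obtain ⟨R, hR, hR1, hRA⟩ := exists_eq_relOf h₀
  obtain ⟨R', hR', hR1', hRA'⟩ := exists_eq_relOf h₁
  rw [hRA, hRA'] at hinf
  obtain ⟨T, T', hT, hT', hT1, hT1', hST, hST', J, hJinj, hJmem, hJker, hsum⟩ :=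
    exists_resolvent_decomposition hR hR1 hR' hR1' hinf
  have hF := isFriedrichsExtension_relOf hT hT1 hST
  have hK := isFriedrichsExtension_relOf hT' hT1' hST'
  rw [sumRange_relInv] at hK
  have hSF : S.graph ≤ relOf (coreMap T (sumRange S.graph) ∘L (coreMap T (sumRange S.graph))†) :=
    fun p hp ↦ by
      rw [mem_relOf, coreMap_comp_adjoint_apply_of_mem hT (add_mem_sumRange hp)]
      exact hST hp
  refine ⟨?_, fun hn _ ↦ ?_⟩
  -- With zero-dimensional sources for α and η and μ = 1, the resolvents are A A* and 1 - B B*.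
  · refine ⟨_, _, isSpecialPair_of_decomposition (G₀ := EuclideanSpace ℂ (Fin 0))
      (G₁ := (sumRange S.graph)ᗮ) (G₂ := EuclideanSpace ℂ (Fin 0)) hsum
      (fun w ↦ coreMap_eq_zero_of_mem_orthogonal hT)
      (fun w ↦ coreMap_eq_zero_of_mem_orthogonal hT') hJinj hJmem hJker hSF
      (α := 0) (μ := 1) (η := 0) ?_ (fun x y h ↦ ⟨Subsingleton.elim _ _, ?_⟩)
      (fun y z h ↦ h) (fun n hn ↦ ?_)⟩
    · rw [ContinuousLinearMap.adjoint_one]; ext n; simp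
    · simpa using h
    · rwa [ContinuousLinearMap.adjoint_one] at hn
  · have hN := not_finiteDimensional_of_defectNumber hR (fun p hp ↦ (hinf.ge hp).1) hn
    obtain ⟨α, μ, η, hone, hαμ, hμη, hμ⟩ := exists_one_decomposition hN
    refine ⟨_, _, _, relOf (1 - coreMap T' (sumRange S.graph) ∘L (coreMap T' (sumRange S.graph))†),
      isSpecialPair_of_decomposition hsum (fun w ↦ coreMap_eq_zero_of_mem_orthogonal hT)
        (fun w ↦ coreMap_eq_zero_of_mem_orthogonal hT') hJinj hJmem hJker hSF hone hαμ hμη hμ,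
      hF, ?_, fun heq ↦ ?_⟩
    · rw [IsKreinExtension, relInv_relOf, sub_sub_cancel]
      exact hK
    · have hex : (lp.single 2 0 1 : L2Seq) ≠ 0 := fun h0 ↦ by
        have := congrArg (fun x : L2Seq ↦ x 0) h0
        simp at this
      -- It is enough that S₀ is neither extension: S₀ = S_F would give Jα = 0, and S₀ = S_K would
      -- give Jμ = 0, both excluded by injectivity of J and of the row (α, μ).
      rcases heq.subset (Set.mem_insert _ _) with h | h
      · have h1 := relOf_injective h
        rw [add_eq_left] at h1
        have h2 : J ∘L α = 0 := eq_zero_of_comp_adjoint_apply_eq_zero fun g ↦ by rw [h1]; rfl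
        have h3 : α (lp.single 2 0 1) = 0 := hJinj _ (DFunLike.congr_fun h2 _)
        exact hex (hαμ _ 0 (by rw [h3, map_zero, add_zero])).1
      · have h1 := relOf_injective (Set.mem_singleton_iff.1 h)
        rw [← hsum, comp_adjoint_eq_add hone J] at h1
        have h2 : (J ∘L μ) ∘L (J ∘L μ)† + (J ∘L η) ∘L (J ∘L η)† = 0 := by
          rw [add_sub_cancel_right, ← add_assoc, ← add_assoc, add_assoc _ _ ((J ∘L η) ∘L _)] at h1
          exact (left_eq_add.1 h1)
        have h3 : J ∘L μ = 0 := eq_zero_of_comp_adjoint_apply_eq_zero fun g ↦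
          IsPositive.apply_eq_zero_of_add
            (ContinuousLinearMap.isPositive_self_comp_adjoint (J ∘L μ))
            (ContinuousLinearMap.isPositive_self_comp_adjoint (J ∘L η)) (by rw [h2]; rfl)
        have h4 : μ (WithLp.toLp 2 (lp.single 2 0 1, 0)) = 0 :=
          hJinj _ (DFunLike.congr_fun h3 _)
        have h5 := (hαμ 0 _ (by rw [h4, map_zero, add_zero])).2
        exact hex (congrArg (fun z ↦ z.fst) h5)
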